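/- Let $F$ be a field of characteristic $0$ (not necessarily algebraically closed) and let $M\neq 0$ be an additive subgroup of $F$ (not necessarily of finite rank). The generalized Virasoro algebra $\mathrm{Vir}[M]$ is the Lie algebra over $F$ with basis $\{L_\mu, c \mid \mu\in M\}$ and brackets $$[L_\mu,L_\nu]=(\nu-\mu)L_{\mu+\nu}+\tfrac1{12}(\mu^3-\mu)\,\delta_{\mu+\nu,0}\,c,\qquad [c,L_\mu]=[c,c]=0 \qquad(\mu,\nu\in M).$$ For $a,b\in F$ let $A_{a,b}(M)$, $A_a(M)$, $B_a(M)$ be the $\mathrm{Vir}[M]$-modules with basis $\{v_\nu\mid \nu\in M\}$ on which $c$ acts as $0$ and, for all $\mu,\nu\in M$, - $A_{a,b}(M)$: $L_\mu v_\nu=(a+\nu+\mu b)v_{\mu+\nu}$; - $A_a(M)$: $L_\mu v_\nu=(\nu+\mu)v_{\mu+\nu}$ if $\nu\ne0$, and $L_\mu v_0=\mu(\mu+a)v_\mu$; - $B_a(M)$: $L_\mu v_\nu=\nu v_{\mu+\nu}$ if $\nu\neq-\mu$, and $L_\mu v_{-\mu}=-\mu(\mu+a)v_0$. A module of the intermediate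 series over $\mathrm{Vir}[M]$ is a nonzero $\mathrm{Vir}[M]$-module $V$ that is not the direct sum of two nonzero submodules and satisfies $V=\bigoplus_{\lambda\in F}V_\lambda$ with $\dim V_\lambda\le 1$ for all $\lambda\in F$, where $V_\lambda=\{v\in V\mid L_0v=\lambda v\}$. **Theorem 4.6.** Every module of the intermediate series over $\mathrm{Vir}[M]$ is isomorphic to one of the modules $A_{a,b}(M)$, $A_a(M)$, $B_a(M)$ with $a,b\in F$, or to a nonzero subquotient of one of them. -/

import Mathlib

namespace GenVir

universe u w

/-- The underlying vector space of the generalized Virasoro algebra `Vir[M]`: the `F`-vector space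
with basis indexed by `Option M`, where `some μ` indexes `L_μ` and `none` indexes `c`. -/
def Vir {F : Type u} [Field F] (M : AddSubgroup F) : Type u := Option M →₀ F

section Algebra

variable {F : Type u} [Field F] (M : AddSubgroup F)

noncomputable instance : AddCommGroup (Vir M) := inferInstanceAs (AddCommGroup (Option M →₀ F))

noncomputable instance : Module F (Vir M) := inferInstanceAs (Module F (Option M →₀ F))

/-- The defining basis of `Vir[M]`. -/
noncomputable def virBasis : Module.Basis (Option M) F (Vir M) := Module.Basis.ofRepr (LinearEquiv.refl F (Option M →₀ F))

variable {M}

/-- The basis element `L_μ`. -/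
noncomputable def L (μ : M) : Vir M := virBasis M (some μ)

variable (M) in
/-- The basis element `c`. -/
noncomputable def c : Vir M := virBasis M none

open Classical in
/-- The bracket on basis elements:
`[L_μ, L_ν] = (ν - μ) L_{μ+ν} + (1/12) (μ³ - μ) δ_{μ+ν,0} c`, and all brackets with `c` vanish. -/
noncomputable def basisBracket : Option M → Option M → Vir M
  | some μ, some ν => ((ν : F) - (μ : F)) • L (μ + ν) +
      (if μ + ν = 0 then (1 / 12 : F) * ((μ : F) ^ 3 - (μ : F)) else 0) • c M
  | _, _ => 0

theorem virBasis_some (μ : M) : virBasis M (some μ) = L μ := rfl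

theorem virBasis_none : virBasis M none = c M := rfl

variable (M) in
/-- The bilinear extension of the bracket on basis elements. -/
noncomputable def virBracket : Vir M →ₗ[F] Vir M →ₗ[F] Vir M :=
  (virBasis M).constr F fun i => (virBasis M).constr F fun j => basisBracket i j

theorem virBracket_basis (i j : Option M) :
    virBracket M (virBasis M i) (virBasis M j) = basisBracket i j := by
  simp [virBracket, Module.Basis.constr_basis]

theorem virBracket_L_L (μ ν : M) : virBracket M (L μ) (L ν) = basisBracket (some μ) (some ν) :=
  virBracket_basis _ _

theorem virBracket_c_left (x : Vir M) : virBracket M (c M) x = 0 := by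
  have : virBracket M (c M) = 0 := (virBasis M).ext fun j => by
    rw [c, virBracket_basis]; rfl
  simp [this]

theorem virBracket_c_right (x : Vir M) : virBracket M x (c M) = 0 := by
  have : (virBracket M).flip (c M) = 0 := (virBasis M).ext fun j => by
    rw [LinearMap.flip_apply, c, virBracket_basis]; cases j <;> rfl
  simpa using congrArg (fun f => f x) this

theorem virBracket_skew_aux : virBracket M = -(virBracket M).flip := by
  refine (virBasis M).ext fun i => (virBasis M).ext fun j => ?_
  simp only [LinearMap.neg_apply, LinearMap.flip_apply, virBracket_basis]
  cases i with
  | none => cases j <;> simp [basisBracket]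
  | some μ =>
    cases j with
    | none => simp [basisBracket]
    | some ν =>
      simp only [basisBracket]
      rw [add_comm ν μ]
      by_cases h : μ + ν = 0
      · obtain rfl : ν = -μ := by rw [← add_eq_zero_iff_neg_eq.mp h]
        simp only [h, if_true]
        push_cast
        module
      · simp only [h, if_false]
        module

theorem virBracket_skew (x y : Vir M) : virBracket M x y = -virBracket M y x := by
  conv_lhs => rw [virBracket_skew_aux]
  rfl

theorem virBracket_jacobi (x y z : Vir M) :
    virBracket M x (virBracket M y z) =
      virBracket M (virBracket M x y) z + virBracket M y (virBracket M x z) := by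
  have key : ∀ i j k : Option M,
      virBracket M (virBasis M i) (virBracket M (virBasis M j) (virBasis M k)) =
      virBracket M (virBracket M (virBasis M i) (virBasis M j)) (virBasis M k) +
        virBracket M (virBasis M j) (virBracket M (virBasis M i) (virBasis M k)) := by
    intro i j k
    cases i with
    | none => simp [virBasis_none, virBracket_c_left, virBracket_c_right]
    | some μ =>
    cases j with
    | none => simp [virBasis_none, virBracket_c_left, virBracket_c_right]
    | some ν =>
    cases k with
    | none => simp [virBasis_none, virBracket_c_left, virBracket_c_right]
    | some ρ =>
      simp only [virBasis_some, virBracket_L_L, basisBracket, map_add, map_smul, LinearMap.add_apply,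
        LinearMap.smul_apply, virBracket_c_left, virBracket_c_right, smul_zero, add_zero,
        smul_add, smul_smul]
      have e1 : μ + (ν + ρ) = μ + ν + ρ := by abel
      have e2 : ν + (μ + ρ) = μ + ν + ρ := by abel
      rw [e1, e2]
      by_cases h : μ + ν + ρ = 0
      · obtain rfl : ρ = -(μ + ν) := (neg_eq_of_add_eq_zero_right h).symm
        simp only [h, if_true]
        push_cast
        module
      · simp only [h, if_false]
        push_cast
        module
  have h1 : ∀ i j : Option M,
      (virBracket M (virBasis M i)) ∘ₗ (virBracket M (virBasis M j)) =
        virBracket M (virBracket M (virBasis M i) (virBasis M j)) +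
        (virBracket M (virBasis M j)) ∘ₗ (virBracket M (virBasis M i)) :=
    fun i j => (virBasis M).ext fun k => key i j k
  have h2 : ∀ i : Option M,
      (virBracket M (virBasis M i)) ∘ₗ (virBracket M).flip z =
        (virBracket M).flip z ∘ₗ (virBracket M (virBasis M i)) +
        (virBracket M).flip (virBracket M (virBasis M i) z) :=
    fun i => (virBasis M).ext fun j => LinearMap.congr_fun (h1 i j) z
  have h3 : (virBracket M).flip (virBracket M y z) =
      (virBracket M).flip z ∘ₗ (virBracket M).flip y +
        (virBracket M y) ∘ₗ (virBracket M).flip z :=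
    (virBasis M).ext fun i => LinearMap.congr_fun (h2 i) y
  exact LinearMap.congr_fun h3 x

end Algebra

section Modules

variable {F : Type u} [Field F] {M : AddSubgroup F}

/-- The linear map `Vir[M] → End (⨁_ν F v_ν)` with `c v_ν = 0` and
`L_μ v_ν = k μ ν • v_{μ+ν}`; here `v_ν` is `Finsupp.single ν 1`. -/
noncomputable def coeffAction (k : M → M → F) : Vir M →ₗ[F] (M →₀ F) →ₗ[F] (M →₀ F) :=
  (virBasis M).constr F fun i => i.elim 0 fun μ =>
    Finsupp.linearCombination F fun ν => Finsupp.single (μ + ν) (k μ ν)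

theorem coeffAction_L (k : M → M → F) (μ ν : M) (t : F) :
    coeffAction k (L μ) (Finsupp.single ν t) = Finsupp.single (μ + ν) (k μ ν * t) := by
  simp [coeffAction, L, Module.Basis.constr_basis, mul_comm]

theorem coeffAction_c (k : M → M → F) (v : M →₀ F) : coeffAction k (c M) v = 0 := by
  simp [coeffAction, c, Module.Basis.constr_basis]

/-- The identity on coefficients which makes `coeffAction` a representation. -/
theorem coeffAction_leibniz (k : M → M → F)
    (hk : ∀ μ ν ρ : M, k μ (ν + ρ) * k ν ρ = ((ν : F) - μ) * k (μ + ν) ρ + k ν (μ + ρ) * k μ ρ)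
    (x y : Vir M) (v : M →₀ F) :
    coeffAction k x (coeffAction k y v) =
      coeffAction k (virBracket M x y) v + coeffAction k y (coeffAction k x v) := by
  have key : ∀ i j : Option M,
      coeffAction k (virBasis M i) ∘ₗ coeffAction k (virBasis M j) =
        coeffAction k (virBracket M (virBasis M i) (virBasis M j)) +
          coeffAction k (virBasis M j) ∘ₗ coeffAction k (virBasis M i) := by
    intro i j
    refine Finsupp.lhom_ext fun ρ t => ?_
    cases i with
    | none => simp [virBasis_none, virBracket_c_left, coeffAction_c]
    | some μ =>
    cases j with
    | none => simp [virBasis_none, virBracket_c_right, coeffAction_c]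
    | some ν =>
      have e : ν + (μ + ρ) = μ + (ν + ρ) := by abel
      simp only [virBasis_some, virBracket_L_L, basisBracket, map_add, map_smul, LinearMap.add_apply,
        LinearMap.smul_apply, coeffAction_c, smul_zero, add_zero, LinearMap.comp_apply,
        coeffAction_L, Finsupp.smul_single, smul_eq_mul, e, add_assoc μ ν ρ]
      rw [← Finsupp.single_add]
      congr 1
      linear_combination t * hk μ ν ρ
  have h1 : ∀ i : Option M,
      (coeffAction k (virBasis M i)) ∘ₗ (coeffAction k).flip v =
        (coeffAction k).flip v ∘ₗ (virBracket M (virBasis M i)) +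
        (coeffAction k).flip (coeffAction k (virBasis M i) v) :=
    fun i => (virBasis M).ext fun j => LinearMap.congr_fun (key i j) v
  have h2 : (coeffAction k).flip (coeffAction k y v) =
      (coeffAction k).flip v ∘ₗ (virBracket M).flip y +
        (coeffAction k y) ∘ₗ (coeffAction k).flip v :=
    (virBasis M).ext fun i => LinearMap.congr_fun (h1 i) y
  exact LinearMap.congr_fun h2 x

/-- Coefficients of `A_{a,b}(M)`: `L_μ v_ν = (a + ν + μ b) v_{μ+ν}`. -/
def coeffAab (a b : F) (μ ν : M) : F := a + (ν : F) + (μ : F) * b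

open Classical in
/-- Coefficients of `A_a(M)`: `L_μ v_ν = (ν + μ) v_{μ+ν}` for `ν ≠ 0`, `L_μ v_0 = μ (μ + a) v_μ`. -/
noncomputable def coeffA (a : F) (μ ν : M) : F :=
  if ν = 0 then (μ : F) * ((μ : F) + a) else (ν : F) + (μ : F)

open Classical in
/-- Coefficients of `B_a(M)`: `L_μ v_ν = ν v_{μ+ν}` for `ν ≠ -μ`,
`L_μ v_{-μ} = -μ (μ + a) v_0`. -/
noncomputable def coeffB (a : F) (μ ν : M) : F :=
  if ν = -μ then -(μ : F) * ((μ : F) + a) else (ν : F)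

theorem coeffAab_identity (a b : F) (μ ν ρ : M) :
    coeffAab a b μ (ν + ρ) * coeffAab a b ν ρ =
      ((ν : F) - μ) * coeffAab a b (μ + ν) ρ + coeffAab a b ν (μ + ρ) * coeffAab a b μ ρ := by
  simp only [coeffAab]; push_cast; ring

theorem coeffA_identity (a : F) (μ ν ρ : M) :
    coeffA a μ (ν + ρ) * coeffA a ν ρ =
      ((ν : F) - μ) * coeffA a (μ + ν) ρ + coeffA a ν (μ + ρ) * coeffA a μ ρ := by
  simp only [coeffA]
  by_cases hρ : ρ = 0
  · subst hρ
    by_cases hν : ν = 0 <;> by_cases hμ : μ = 0 <;> simp [hν, hμ]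
    ring
  · by_cases h1 : ν + ρ = 0 <;> by_cases h2 : μ + ρ = 0
    · obtain rfl : ν = -ρ := eq_neg_of_add_eq_zero_left h1
      obtain rfl : μ = -ρ := eq_neg_of_add_eq_zero_left h2
      simp [hρ]
    · obtain rfl : ν = -ρ := eq_neg_of_add_eq_zero_left h1
      simp [hρ, h2]; ring
    · obtain rfl : μ = -ρ := eq_neg_of_add_eq_zero_left h2
      simp [hρ, h1]; ring
    · simp [hρ, h1, h2]; ring

theorem coeffB_identity (a : F) (μ ν ρ : M) :
    coeffB a μ (ν + ρ) * coeffB a ν ρ =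
      ((ν : F) - μ) * coeffB a (μ + ν) ρ + coeffB a ν (μ + ρ) * coeffB a μ ρ := by
  simp only [coeffB]
  have e1 : ν + ρ = -μ ↔ ρ = -(μ + ν) := by
    constructor <;> intro h
    · rw [neg_add, ← h]; abel
    · rw [h]; abel
  have e2 : μ + ρ = -ν ↔ ρ = -(μ + ν) := by
    constructor <;> intro h
    · rw [neg_add, ← h]; abel
    · rw [h]; abel
  have e3 : -(μ + ν) = -ν ↔ μ = 0 := by simp
  have e4 : -(μ + ν) = -μ ↔ ν = 0 := by simp
  by_cases h : ρ = -(μ + ν)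
  · rw [if_pos (e1.2 h), if_pos h, if_pos (e2.2 h)]
    subst h
    by_cases hμ : μ = 0
    · rw [if_pos (e3.2 hμ)]
      by_cases hν : ν = 0
      · rw [if_pos (e4.2 hν)]
        subst hμ hν
        simp
      · rw [if_neg (fun h' => hν (e4.1 h'))]
        subst hμ
        push_cast
        ring
    · rw [if_neg (fun h' => hμ (e3.1 h'))]
      by_cases hν : ν = 0
      · rw [if_pos (e4.2 hν)]
        subst hν
        push_cast
        ring
      · rw [if_neg (fun h' => hν (e4.1 h'))]
        push_cast
        ring
  · rw [if_neg (fun h' => h (e1.1 h')), if_neg h, if_neg (fun h' => h (e2.1 h'))]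
    by_cases h1 : ρ = -ν
    · rw [if_pos h1]
      by_cases h2 : ρ = -μ
      · rw [if_pos h2]
        have : μ = ν := neg_injective (h2.symm.trans h1)
        subst this
        ring
      · rw [if_neg h2]
        subst h1
        push_cast
        ring
    · rw [if_neg h1]
      by_cases h2 : ρ = -μ
      · rw [if_pos h2]
        subst h2
        push_cast
        ring
      · rw [if_neg h2]
        push_cast
        ring

variable (M) in
/-- The module `A_{a,b}(M)`, with basis `v_ν` (`ν ∈ M`). -/
@[nolint unusedArguments]
def ModAab (_a _b : F) : Type u := M →₀ F

variable (M) in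
/-- The module `A_a(M)`, with basis `v_ν` (`ν ∈ M`). -/
@[nolint unusedArguments]
def ModA (_a : F) : Type u := M →₀ F

variable (M) in
/-- The module `B_a(M)`, with basis `v_ν` (`ν ∈ M`). -/
@[nolint unusedArguments]
def ModB (_a : F) : Type u := M →₀ F

noncomputable instance (a b : F) : AddCommGroup (ModAab M a b) :=
  inferInstanceAs (AddCommGroup (M →₀ F))
noncomputable instance (a b : F) : Module F (ModAab M a b) := inferInstanceAs (Module F (M →₀ F))
noncomputable instance (a : F) : AddCommGroup (ModA M a) :=
  inferInstanceAs (AddCommGroup (M →₀ F))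
noncomputable instance (a : F) : Module F (ModA M a) := inferInstanceAs (Module F (M →₀ F))
noncomputable instance (a : F) : AddCommGroup (ModB M a) :=
  inferInstanceAs (AddCommGroup (M →₀ F))
noncomputable instance (a : F) : Module F (ModB M a) := inferInstanceAs (Module F (M →₀ F))

variable [CharZero F]

/-- `Vir[M]` is a Lie algebra with the bracket above. -/
noncomputable instance : LieRing (Vir M) where
  bracket x y := virBracket M x y
  add_lie x y z := by simp
  lie_add x y z := by simp
  lie_self x := by
    have h : (2 : F) • virBracket M x x = 0 := by
      rw [two_smul]
      nth_rewrite 1 [virBracket_skew]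
      exact neg_add_cancel _
    exact (smul_eq_zero.mp h).resolve_left two_ne_zero
  leibniz_lie := virBracket_jacobi

noncomputable instance : LieAlgebra F (Vir M) where
  lie_smul t x y := (virBracket M x).map_smul t y

noncomputable instance (a b : F) : LieRingModule (Vir M) (ModAab M a b) where
  bracket x v := (coeffAction (coeffAab a b) x v : M →₀ F)
  add_lie x y v := LinearMap.congr_fun (map_add (coeffAction (coeffAab a b)) x y) v
  lie_add x v w := map_add (coeffAction (coeffAab a b) x) v w
  leibniz_lie := coeffAction_leibniz _ (coeffAab_identity a b)

noncomputable instance (a b : F) : LieModule F (Vir M) (ModAab M a b) where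
  smul_lie t x v := LinearMap.congr_fun (map_smul (coeffAction (coeffAab a b)) t x) v
  lie_smul t x v := map_smul (coeffAction (coeffAab a b) x) t v

noncomputable instance (a : F) : LieRingModule (Vir M) (ModA M a) where
  bracket x v := (coeffAction (coeffA a) x v : M →₀ F)
  add_lie x y v := LinearMap.congr_fun (map_add (coeffAction (coeffA a)) x y) v
  lie_add x v w := map_add (coeffAction (coeffA a) x) v w
  leibniz_lie := coeffAction_leibniz _ (coeffA_identity a)

noncomputable instance (a : F) : LieModule F (Vir M) (ModA M a) where
  smul_lie t x v := LinearMap.congr_fun (map_smul (coeffAction (coeffA a)) t x) v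
  lie_smul t x v := map_smul (coeffAction (coeffA a) x) t v

noncomputable instance (a : F) : LieRingModule (Vir M) (ModB M a) where
  bracket x v := (coeffAction (coeffB a) x v : M →₀ F)
  add_lie x y v := LinearMap.congr_fun (map_add (coeffAction (coeffB a)) x y) v
  lie_add x v w := map_add (coeffAction (coeffB a) x) v w
  leibniz_lie := coeffAction_leibniz _ (coeffB_identity a)

noncomputable instance (a : F) : LieModule F (Vir M) (ModB M a) where
  smul_lie t x v := LinearMap.congr_fun (map_smul (coeffAction (coeffB a)) t x) v
  lie_smul t x v := map_smul (coeffAction (coeffB a) x) t v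

section Intermediate

variable (M) (V : Type w) [AddCommGroup V] [Module F V] [LieRingModule (Vir M) V]
  [LieModule F (Vir M) V]

/-- The weight space `V_l = {v ∈ V | L_0 v = l v}`. -/
noncomputable def weightSpace (l : F) : Submodule F V :=
  Module.End.eigenspace (LieModule.toEnd F (Vir M) V (L (0 : M))) l

open Classical in
/-- Harish-Chandra modules: `V = ⨁_l V_l` with all `V_l` finite-dimensional. -/
def IsHarishChandra : Prop :=
  DirectSum.IsInternal (weightSpace M V) ∧ ∀ l : F, FiniteDimensional F (weightSpace M V l)

/-- `V` is nonzero and is not the direct sum of two nonzero submodules. -/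
def IsIndecomposable : Prop :=
  Nontrivial V ∧ ∀ N P : LieSubmodule F (Vir M) V, IsCompl N P → N = ⊥ ∨ P = ⊥

/-- Modules of the intermediate series. -/
def IsIntermediateSeries : Prop :=
  IsHarishChandra M V ∧ IsIndecomposable M V ∧
    ∀ l : F, Module.finrank F (weightSpace M V l) ≤ 1

/-- `V` is isomorphic, as a `Vir[M]`-module, to a nonzero subquotient `N / P` of `X`. -/
def IsNonzeroSubquotient (X : Type u) [AddCommGroup X] [Module F X] [LieRingModule (Vir M) X]
    [LieModule F (Vir M) X] : Prop :=
  ∃ N P : LieSubmodule F (Vir M) X, P < N ∧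
    Nonempty (V ≃ₗ⁅F, Vir M⁆ (N ⧸ P.comap N.incl))

end Intermediate

end Modules

end GenVir

/-! Indecomposability puts all weights into one coset `a + M` and makes `c` act by a scalar. After a
choice of weight vectors `v_x` the module is a system of scalars, `L_{y-x} v_x = e x y • v_y`,
determined up to rescaling the `v_x`. It is therefore studied through the rescaling invariants:
products of `e` along closed paths, namely round trips `x → y → x` and triangles. The bracket says
how they change when a vertex is reflected in the midpoint of an edge.

On a half line inside the support, round trips are quadratic and triangles cubic in the weight. The
two orientations of a triangle multiply to the product of its three round trips; comparing
coefficients there gives zero central charge (`EdgeRel.ray`). Gaps in the support obey integrality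
conditions (`EdgeRel.gap`). Hence the charge always vanishes (`EdgeRel.charge_eq_zero`), and only
the weight `0` can be missing unless it is the only weight (`EdgeRel.support`).

Next, every round trip equals `(a + x) * (a + y) + K * (x - y) ^ 2`
(`FullEdgeRel.exists_roundTrip`). The constant is compared between two directions at a time, so the
rank of `M` plays no role. The difference of the two orientations of a triangle is `E * ((y - x) *
(z - y) * (x - z))` with `E ^ 2 = K ^ 2 * (1 - 4 * K)`, and this yields `b` in `F` with `K = b * (1
- b)`. So all invariants are those of `A_{a,b}` (`FullEdgeRel.exists_triangle`), and
`exists_rescaling` recovers the coefficients.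

The recovery breaks down only for `K = 0` at the weight `0`, where all round trips vanish. There the
arrows into and out of `0` solve a functional equation with affine solutions, and this is where
`A_a` and `B_a` appear (`FullEdgeRel.zero_weight`). -/

namespace GenVir

/-! ### Polynomial identities along arithmetic progressions -/

section Polynomials

variable {F : Type*} [Field F] [CharZero F]

open Polynomial in
theorem polynomial_eq_zero_of_eval_progression (f : F[X]) (s d : F) (hd : d ≠ 0)
    (h : ∀ n : ℕ, f.eval (s + n * d) = 0) : f = 0 := by
  refine Polynomial.eq_zero_of_infinite_isRoot f ?_
  refine Set.infinite_of_injective_forall_mem (f := fun n : ℕ => s + n * d) ?_ h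
  intro m n hmn
  simpa [hd] using hmn

open Polynomial in
theorem coeffs_eq_zero_of_progression (c0 c1 c2 c3 c4 c5 s d : F) (hd : d ≠ 0)
    (h : ∀ n : ℕ, c5 * (s + n * d) ^ 5 + c4 * (s + n * d) ^ 4 + c3 * (s + n * d) ^ 3 +
      c2 * (s + n * d) ^ 2 + c1 * (s + n * d) + c0 = 0) :
    c0 = 0 ∧ c1 = 0 ∧ c2 = 0 ∧ c3 = 0 ∧ c4 = 0 ∧ c5 = 0 := by
  have := polynomial_eq_zero_of_eval_progression
    (C c5 * X ^ 5 + C c4 * X ^ 4 + C c3 * X ^ 3 + C c2 * X ^ 2 + C c1 * X + C c0) s d hd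
    (fun n => by simpa using h n)
  refine ⟨?_, ?_, ?_, ?_, ?_, ?_⟩
  · simpa [coeff_X, coeff_C] using congrArg (fun f => f.coeff 0) this
  · simpa [coeff_X, coeff_C] using congrArg (fun f => f.coeff 1) this
  · simpa [coeff_X, coeff_C] using congrArg (fun f => f.coeff 2) this
  · simpa [coeff_X, coeff_C] using congrArg (fun f => f.coeff 3) this
  · simpa [coeff_X, coeff_C] using congrArg (fun f => f.coeff 4) this
  · simpa [coeff_X, coeff_C] using congrArg (fun f => f.coeff 5) this

/-- Comparison of coefficients in a product of two cubics which is a product of three quadratics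
along an arithmetic progression. -/
theorem cubic_mul_cubic_coeffs (α β γ γ' b1 b2 b3 c1 c2 c3 s d : F) (hd : d ≠ 0)
    (h : ∀ n : ℕ, ∀ x : F, x = s + n * d →
      (x ^ 3 + α * x ^ 2 + β * x + γ) * (x ^ 3 + α * x ^ 2 + β * x + γ') =
        (x ^ 2 + b1 * x + c1) * (x ^ 2 + b2 * x + c2) * (x ^ 2 + b3 * x + c3)) :
    2 * α = b1 + b2 + b3 ∧ α ^ 2 + 2 * β = c1 + c2 + c3 + b1 * b2 + b1 * b3 + b2 * b3 ∧
    γ + γ' + 2 * α * β = b1 * (c2 + c3) + b2 * (c1 + c3) + b3 * (c1 + c2) + b1 * b2 * b3 ∧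
    γ * γ' = c1 * c2 * c3 := by
  have := coeffs_eq_zero_of_progression
    (γ * γ' - c1 * c2 * c3) (β * (γ + γ') - (b1 * c2 * c3 + b2 * c1 * c3 + b3 * c1 * c2))
    (β ^ 2 + α * (γ + γ') - (c1 * c2 + c1 * c3 + c2 * c3 + b1 * b2 * c3 + b1 * b3 * c2
      + b2 * b3 * c1))
    (γ + γ' + 2 * α * β - (b1 * (c2 + c3) + b2 * (c1 + c3) + b3 * (c1 + c2) + b1 * b2 * b3))
    (α ^ 2 + 2 * β - (c1 + c2 + c3 + b1 * b2 + b1 * b3 + b2 * b3))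
    (2 * α - (b1 + b2 + b3)) s d hd (fun n => by linear_combination h n _ rfl)
  obtain ⟨h0, -, -, h3, h4, h5⟩ := this
  exact ⟨sub_eq_zero.1 h5, sub_eq_zero.1 h4, sub_eq_zero.1 h3, sub_eq_zero.1 h0⟩

end Polynomials

/-! ### Matrix coefficients, their closed-path invariants, and the half-line computation -/

section Edges

variable {F : Type*} [Field F] {M : AddSubgroup F}

/-- The scalar of the round trip between the weight vectors `x` and `y`. -/
def roundTrip (e : M → M → F) (x y : M) : F := e x y * e y x

/-- The scalar of the closed path `x → y → z → x`. -/
def triangle (e : M → M → F) (x y z : M) : F := e x y * e y z * e z x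

/-- The relations satisfied by the matrix coefficients `L_{y-x} v_x = e x y • v_y` of a module with
weight vectors `v_x`, `x ∈ S`, of weight `a + x` on which `c` acts as `12 κ`. -/
structure EdgeRel (a : F) (S : Set M) (κ : F) (e : M → M → F) : Prop where
  zero_left : ∀ x y, x ∉ S → e x y = 0
  zero_right : ∀ x y, y ∉ S → e x y = 0
  rel : ∀ x ∈ S, ∀ z ∈ S, x ≠ z → ∀ y y', y + y' = x + z →
    e x y * e y z - e x y' * e y' z = ((y : F) - y') * e x z
  rel_self : ∀ x ∈ S, ∀ μ : M, roundTrip e x (x + μ) - roundTrip e x (x - μ) =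
    2 * μ * (a + x) - κ * ((μ : F) ^ 3 - μ)

variable {a : F} {S : Set M} {κ : F} {e : M → M → F}

theorem roundTrip_comm (x y : M) : roundTrip e x y = roundTrip e y x := mul_comm _ _

theorem triangle_mul_triangle (x y z : M) : triangle e x y z * triangle e x z y =
    roundTrip e x y * roundTrip e y z * roundTrip e x z := by
  simp only [triangle, roundTrip]; ring

theorem triangle_rotate (x y z : M) : triangle e x y z = triangle e y z x := by
  simp only [triangle]; ring

/-- Closing the paths of the commutator relation with the arrow `e z x` makes it invariant under
rescaling; `y'` is the mirror image of `y` in the midpoint of `x` and `z`. -/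
theorem EdgeRel.triangle_reflect (h : EdgeRel a S κ e) {x z : M} (hx : x ∈ S) (hz : z ∈ S)
    (hxz : x ≠ z) (y y' : M) (hy : y + y' = x + z) :
    triangle e x y z - triangle e x y' z = ((y : F) - y') * roundTrip e x z := by
  simp only [triangle, roundTrip]
  linear_combination e z x * h.rel x hx z hz hxz y y' hy

theorem EdgeRel.triangle_reflect' (h : EdgeRel a S κ e) {x z : M} (hx : x ∈ S) (hz : z ∈ S)
    (hxz : x ≠ z) (y y' : M) (hy : y + y' = x + z) :
    triangle e x z y - triangle e x z y' = ((y : F) - y') * roundTrip e x z := by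
  simp only [triangle, roundTrip]
  linear_combination e x z * h.rel z hz x hx hxz.symm y y' (by rw [hy, add_comm])

variable [CharZero F]

/-- Edge relations along a half line contained in the support. -/
theorem EdgeRel.ray (h : EdgeRel a S κ e) (x δ : M) (hδ : δ ≠ 0)
    (hS : ∀ n : ℕ, x + n • δ ∈ S) :
    κ = 0 ∧ ∃ K D : F, D ^ 2 = 4 * K ^ 2 * ((δ : F) ^ 2 - 4 * K) ∧
      (∀ n : ℕ, roundTrip e (x + n • δ) (x + (n + 1) • δ) =
        (a + x + n * δ) * (a + x + (n + 1) * δ) + K) ∧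
      (∀ n : ℕ, roundTrip e (x + n • δ) (x + (n + 2) • δ) =
        (a + x + n * δ) * (a + x + (n + 2) * δ) + 4 * K) ∧
      (∀ n : ℕ, triangle e (x + n • δ) (x + (n + 1) • δ) (x + (n + 2) • δ) -
        triangle e (x + n • δ) (x + (n + 2) • δ) (x + (n + 1) • δ) = D) := by
  have hd : (δ : F) ≠ 0 := by simpa using hδ
  set p : ℕ → M := fun n => x + n • δ with hp
  set w : F := a + x with hw
  have hpc : ∀ n, a + (p n : F) = w + n * δ := fun n => by simp [hp, hw, add_assoc]
  have hne : ∀ m n, m ≠ n → p m ≠ p n := by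
    intro m n hmn hh
    have := congrArg (fun t : M => (t : F)) hh
    simp [hp, hd] at this
    exact hmn this
  set ζ : F := κ * ((δ : F) ^ 2 - 1) with hζ
  set ζ2 : F := κ * (4 * (δ : F) ^ 2 - 1) with hζ2
  set P1 : ℕ → F := fun n => roundTrip e (p n) (p (n + 1)) with hP1
  set P2 : ℕ → F := fun n => roundTrip e (p n) (p (n + 2)) with hP2
  set T : ℕ → F := fun n => triangle e (p n) (p (n + 1)) (p (n + 2)) with hT
  set T' : ℕ → F := fun n => triangle e (p n) (p (n + 2)) (p (n + 1)) with hT'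
  have rP1 : ∀ n : ℕ, P1 (n + 1) = P1 n + 2 * δ * (w + (n + 1) * δ) - ζ * δ := by
    intro n
    have h1 := h.rel_self (p (n + 1)) (hS _) δ
    have e1 : p (n + 1) + δ = p (n + 1 + 1) := by simp only [hp, succ_nsmul]; abel
    have e2 : p (n + 1) - δ = p n := by simp only [hp, succ_nsmul]; abel
    rw [e1, e2, hpc, roundTrip_comm (p (n + 1)) (p n)] at h1
    push_cast at h1
    simp only [hP1, hζ]
    linear_combination h1
  have rP2 : ∀ n : ℕ, P2 (n + 2) = P2 n + 4 * δ * (w + (n + 2) * δ) - 2 * ζ2 * δ := by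
    intro n
    have h1 := h.rel_self (p (n + 2)) (hS _) (2 • δ)
    have e1 : p (n + 2) + 2 • δ = p (n + 2 + 2) := by simp only [hp, add_nsmul]; abel
    have e2 : p (n + 2) - 2 • δ = p n := by simp only [hp, add_nsmul]; abel
    rw [e1, e2, hpc, roundTrip_comm (p (n + 2)) (p n)] at h1
    push_cast at h1
    simp only [hP2, hζ2]
    simp only [nsmul_eq_mul] at h1
    push_cast at h1
    linear_combination h1
  -- Reflecting `p n` across the edge from `p (n + 1)` to `p (n + 2)` gives `p (n + 3)`, at distance
  -- `3 * δ`.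
  have rT : ∀ n : ℕ, T (n + 1) = T n + 3 * δ * P1 (n + 1) := by
    intro n
    have h1 := h.triangle_reflect' (hS (n + 1)) (hS (n + 2)) (hne _ _ (by omega)) (p (n + 3)) (p n)
      (by simp only [hp, add_nsmul, one_nsmul]; abel)
    have e1 : ((p (n + 3) : M) : F) - p n = 3 * δ := by simp [hp]; ring
    rw [e1, ← triangle_rotate (p n)] at h1
    simp only [hT, hP1]
    linear_combination h1
  have rT' : ∀ n : ℕ, T' (n + 1) = T' n + 3 * δ * P1 (n + 1) := by
    intro n
    have h1 := h.triangle_reflect (hS (n + 1)) (hS (n + 2)) (hne _ _ (by omega)) (p (n + 3)) (p n)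
      (by simp only [hp, add_nsmul, one_nsmul]; abel)
    have e1 : ((p (n + 3) : M) : F) - p n = 3 * δ := by simp [hp]; ring
    rw [e1, triangle_rotate (p (n + 1)) (p n)] at h1
    simp only [hT', hP1]
    linear_combination h1
  have hprod : ∀ n, T n * T' n = P1 n * P1 (n + 1) * P2 n := fun n => triangle_mul_triangle _ _ _
  set K : F := P1 0 - w * (w + δ) with hK
  have cP1 : ∀ n : ℕ, P1 n = (w + n * δ) * (w + (n + 1) * δ) + K - ζ * (n * δ) := by
    intro n
    induction n with
    | zero => simp [hK]
    | succ n ih => rw [rP1, ih]; push_cast; ring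
  -- Coefficients of the cubic, in the weight `s` of the middle vertex, that solves `rT`; `T'`
  -- differs from it by the constant `D`.
  set α : F := -3 / 2 * ζ with hα
  set K' : F := K + ζ * w with hK'
  set β : F := 3 * K' - (δ : F) ^ 2 + 3 * ζ * δ / 2 with hβ
  set γ : F := T 0 - ((w + δ) ^ 3 + α * (w + δ) ^ 2 + β * (w + δ)) with hγ
  set D : F := T 0 - T' 0 with hD
  have cD : ∀ n : ℕ, T n - T' n = D := by
    intro n
    induction n with
    | zero => rfl
    | succ n ih => rw [rT, rT', ← ih]; ring
  have cT : ∀ n : ℕ, ∀ s : F, s = w + (n + 1) * δ → T n = s ^ 3 + α * s ^ 2 + β * s + γ := by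
    intro n
    induction n with
    | zero => intro s hs; simp [hγ, hs]
    | succ n ih =>
      intro s hs
      rw [rT, ih _ rfl, cP1, hs]
      push_cast
      simp only [hα, hβ, hK']
      ring
  -- `P2` has only a recursion of step two, so each start `r` gets its own progression of step `2 *
  -- δ`. In `T * T' = P1 * P1 * P2`, degree 5 gives `ζ = ζ2`, degree 4 determines `P2`, and degrees
  -- 3 and 0 give the equation for `D`.
  have key : ∀ r : ℕ, ζ = ζ2 ∧ (ζ = 0 → P2 r - (w + r * δ) * (w + (r + 2) * δ) = 4 * K) ∧
      (ζ = 0 → D ^ 2 = 4 * K ^ 2 * ((δ : F) ^ 2 - 4 * K)) := by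
    intro r
    set J : F := P2 r - (w + r * δ) * (w + (r + 2) * δ) with hJ
    have cP2 : ∀ m : ℕ, P2 (r + 2 * m) = (w + (r + 2 * m) * δ) * (w + (r + 2 * m + 2) * δ) + J -
        ζ2 * (2 * m * δ) := by
      intro m
      induction m with
      | zero => simp [hJ]
      | succ m ih =>
        rw [show r + 2 * (m + 1) = r + 2 * m + 2 by ring, rP2, ih]; push_cast; ring
    set J' : F := J + ζ2 * (w + r * δ) with hJ'
    have := cubic_mul_cubic_coeffs α β γ (γ - D) (-(δ + ζ)) (δ - ζ) (-ζ2) (K' + ζ * δ) K'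
      (J' + ζ2 * δ - (δ : F) ^ 2) (w + (r + 1) * δ) (2 * δ) (by simpa using hd) (by
        intro m s hs
        have h1 := hprod (r + 2 * m)
        have h2 := cT (r + 2 * m) s (by rw [hs]; push_cast; ring)
        have h3 : T' (r + 2 * m) = s ^ 3 + α * s ^ 2 + β * s + (γ - D) := by
          rw [← cD (r + 2 * m), ← add_sub_assoc, ← h2]; ring
        rw [h2, h3, cP1, cP1, cP2] at h1
        rw [h1, hs]
        push_cast
        simp only [hK', hJ']
        ring)
    obtain ⟨h5, h4, h3, h0⟩ := this
    have hz : ζ = ζ2 := by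
      have : ζ - ζ2 = 0 := by linear_combination -h5 - 2 * hα
      exact sub_eq_zero.1 this
    refine ⟨hz, ?_, ?_⟩
    · intro hz0
      rw [← hz] at hJ'
      simp only [hα, hβ, hJ', hK', ← hz, hz0] at h4
      linear_combination -h4
    · intro hz0
      rw [← hz] at hJ'
      have hJK : J = 4 * K := by
        simp only [hα, hβ, hJ', hK', ← hz, hz0] at h4
        linear_combination -h4
      simp only [hα, hJ', hK', ← hz, hz0] at h3 h0
      have hγD : 2 * γ = D := by linear_combination h3
      rw [hJK] at h0
      linear_combination (-4) * h0 + (2 * γ - D) * hγD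
  have hκ : κ = 0 := by
    have h1 := (key 0).1
    have h2 : 3 * κ * (δ : F) ^ 2 = 0 := by
      simp only [hζ, hζ2] at h1
      linear_combination -h1
    simpa [hd] using h2
  have hζ0 : ζ = 0 := by rw [hζ, hκ, zero_mul]
  refine ⟨hκ, K, D, (key 0).2.2 hζ0, fun n => ?_, fun n => ?_, cD⟩
  · have := cP1 n
    rw [hζ0] at this
    simpa using this
  · have := (key n).2.1 hζ0
    change P2 n = _
    linear_combination this

end Edges


/-! ### Gaps in the support and vanishing of the central charge -/

section Support

variable {F : Type*} [Field F] {M : AddSubgroup F}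
  {a : F} {S : Set M} {κ : F} {e : M → M → F}

theorem EdgeRel.mem_right (h : EdgeRel a S κ e) {x y : M} (hxy : roundTrip e x y ≠ 0) : y ∈ S := by
  by_contra hx
  exact hxy (by simp [roundTrip, h.zero_left y x hx])

theorem EdgeRel.roundTrip_eq_zero (h : EdgeRel a S κ e) {x y : M} (hy : y ∉ S) :
    roundTrip e x y = 0 := by
  simp [roundTrip, h.zero_left y x hy]

/-- Once the central charge vanishes and no nonzero weight is missing, the relations hold for all
pairs of points. -/
theorem EdgeRel.extend (h : EdgeRel a S 0 e) (hS : ∀ x : M, a + (x : F) ≠ 0 → x ∈ S)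
    (hself : ∀ x ∈ S, e x x = a + x) : EdgeRel a Set.univ 0 e ∧ ∀ x, e x x = a + x := by
  have hz : ∀ x, x ∉ S → a + (x : F) = 0 := fun x hx => by
    by_contra h0; exact hx (hS x h0)
  refine ⟨⟨fun x y hx => absurd trivial hx, fun x y hx => absurd trivial hx, ?_, ?_⟩, ?_⟩
  · intro x _ z _ hxz y y' hy
    by_cases hx : x ∈ S
    · by_cases hz' : z ∈ S
      · exact h.rel x hx z hz' hxz y y' hy
      · simp [h.zero_right _ _ hz']
    · simp [h.zero_left _ _ hx]
  · intro x _ μ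
    by_cases hx : x ∈ S
    · exact h.rel_self x hx μ
    -- A missing point has weight `0`, so the right-hand side vanishes too.
    · simp [roundTrip, h.zero_left _ _ hx, hz x hx]
  · intro x
    by_cases hx : x ∈ S
    · exact hself x hx
    · rw [h.zero_left _ _ hx, hz x hx]

variable [CharZero F]

/-- A gap in the support next to a point of the support. -/
theorem EdgeRel.gap (h : EdgeRel a S κ e) (x δ : M) (hδ : δ ≠ 0) (hx : x ∈ S) (hg : x + δ ∉ S) :
    (∃ N : ℕ, 2 * (δ : F) * (a + x) - κ * ((δ : F) ^ 3 - δ) = N * (δ : F) ^ 2) ∨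
      (κ = 0 ∧ a + ((x + δ : M) : F) = 0) := by
  by_cases hN : ∃ N : ℕ, 2 * (δ : F) * (a + x) - κ * ((δ : F) ^ 3 - δ) = N * (δ : F) ^ 2
  · exact Or.inl hN
  right
  push Not at hN
  have hd : (δ : F) ≠ 0 := by simpa using hδ
  set p : ℕ → M := fun n => x + n • (-δ) with hp
  have hpc : ∀ n, (p n : F) = x - n * δ := fun n => by simp [hp]; ring
  -- Walking away from the gap, the recursion starts with the zero round trip to `x + δ`. The closed
  -- form vanishes only in the case already set aside, so the walk stays in the support and
  -- `EdgeRel.ray` applies.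
  have hP : ∀ n : ℕ, (∀ k ≤ n, p k ∈ S) → roundTrip e (p n) (p (n + 1)) =
      (n + 1) * (n * (δ : F) ^ 2 - (2 * δ * (a + x) - κ * ((δ : F) ^ 3 - δ))) := by
    intro n
    induction n with
    | zero =>
      intro hk
      have h1 := h.rel_self x hx δ
      rw [h.roundTrip_eq_zero hg] at h1
      have e1 : p (0 + 1) = x - δ := by simp [hp, sub_eq_add_neg]
      have e0 : p 0 = x := by simp [hp]
      rw [e0, e1]
      push_cast
      linear_combination -h1
    | succ n ih =>
      intro hk
      have h1 := h.rel_self (p (n + 1)) (hk _ le_rfl) δ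
      have e1 : p (n + 1) + δ = p n := by simp only [hp, add_nsmul, one_nsmul]; abel
      have e2 : p (n + 1) - δ = p (n + 1 + 1) := by simp only [hp, add_nsmul, one_nsmul]; abel
      rw [e1, e2, hpc, roundTrip_comm, ih (fun k hkn => hk k (by omega))] at h1
      push_cast at h1 ⊢
      linear_combination -h1
  have hmem : ∀ n, ∀ k ≤ n, p k ∈ S := by
    intro n
    induction n with
    | zero => intro k hk; obtain rfl : k = 0 := by omega
              simpa [hp] using hx
    | succ n ih =>
      intro k hk
      rcases Nat.lt_or_ge k (n + 1) with hlt | hge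
      · exact ih k (by omega)
      · obtain rfl : k = n + 1 := by omega
        apply h.mem_right (x := p n)
        rw [hP n ih]
        refine mul_ne_zero (by exact_mod_cast Nat.succ_ne_zero n) ?_
        rw [sub_ne_zero]
        exact (hN n).symm
  obtain ⟨hκ, K, D, hD, h1, h2, hT⟩ := h.ray x (-δ) (by simpa using hδ) (fun n => hmem n n le_rfl)
  refine ⟨hκ, ?_⟩
  have hP0 := hP 0 (hmem 0)
  have k1 := h1 0
  rw [hP0, hκ] at k1
  have hm1 : x - δ ∈ S := by
    have := hmem 1 1 le_rfl
    simpa [hp, sub_eq_add_neg] using this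
  -- The missing point is used twice more: as the end of a double step from `x - δ`, and as the
  -- mirror image of `x - 2 • δ`, which forces `D = 0`.
  have k2 := h.rel_self (x - δ) hm1 (2 • δ)
  have e1 : x - δ + 2 • δ = x + δ := by rw [two_nsmul]; abel
  rw [e1, h.roundTrip_eq_zero hg] at k2
  have k3 := h2 1
  have e2 : x + 1 • -δ = x - δ := by rw [one_nsmul]; abel
  have e3 : x + (1 + 2) • -δ = x - δ - 2 • δ := by simp only [add_nsmul, two_nsmul, one_nsmul]; abel
  rw [e2, e3] at k3
  rw [k3, hκ] at k2
  have hne : x ≠ x - δ := by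
    intro hh
    exact hδ (sub_eq_self.1 hh.symm)
  have hrefl : (x - 2 • δ) + (x + δ) = x + (x - δ) := by rw [two_nsmul]; abel
  have t1 := h.triangle_reflect hx hm1 hne (x - 2 • δ) (x + δ) hrefl
  have t2 := h.triangle_reflect' hx hm1 hne (x - 2 • δ) (x + δ) hrefl
  have z1 : triangle e x (x + δ) (x - δ) = 0 := by simp [triangle, h.zero_right _ _ hg]
  have z2 : triangle e x (x - δ) (x + δ) = 0 := by simp [triangle, h.zero_right _ _ hg]
  have t3 := hT 0
  have e0 : x + 0 • -δ = x := by simp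
  have e4 : x + (0 + 1) • -δ = x - δ := by simp [sub_eq_add_neg]
  have e5 : x + (0 + 2) • -δ = x - 2 • δ := by simp [sub_eq_add_neg]
  rw [e0, e4, e5] at t3
  have hD0 : D = 0 := by
    rw [← t3]
    linear_combination t2 - t1 - z1 + z2
  rw [hD0] at hD
  push_cast at k1 k2 hD ⊢
  simp only [nsmul_eq_mul] at k2
  push_cast at k2
  set w : F := a + x with hw
  -- Single and double steps leave `w = -δ`, which is the claim, or `δ = -3 * w`. In the latter case
  -- `K * (δ ^ 2 - 4 * K) = 2 * w ^ 4`, against `D = 0`.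
  have hK : K = -w * (w + δ) := by linear_combination -k1
  have hK2 : (w + δ) * (3 * w + δ) = 0 := by
    linear_combination k2 + 4 * hK
  have hD' : K * (δ ^ 2 - 4 * K) = 0 := by
    have : K ^ 2 * ((δ : F) ^ 2 - 4 * K) = 0 := by
      linear_combination (-1 / 4 : F) * hD
    rcases mul_eq_zero.1 this with h' | h'
    · rw [pow_eq_zero_iff two_ne_zero] at h'; rw [h', zero_mul]
    · rw [h', mul_zero]
  rcases mul_eq_zero.1 hK2 with h' | h'
  · rw [← h', hw]; ring
  · have hδw : (δ : F) = -3 * w := by linear_combination h'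
    rw [hK, hδw] at hD'
    have : w ^ 4 = 0 := by linear_combination (1 / 2 : F) * hD'
    rw [pow_eq_zero_iff (by norm_num)] at this
    rw [this] at hδw
    exact absurd (by simpa using hδw) hd

/-- The central charge vanishes. -/
theorem EdgeRel.charge_eq_zero (h : EdgeRel a S κ e) (hS : S.Nonempty) (hM : M ≠ ⊥) : κ = 0 := by
  by_contra hκ
  obtain ⟨x, hx⟩ := hS
  obtain ⟨δ, hδM, hd⟩ := (AddSubgroup.ne_bot_iff_exists_ne_zero).1 hM |>.elim
    (fun δ hδ => (⟨δ, δ.2, by simpa using hδ⟩ : ∃ δ : F, δ ∈ M ∧ δ ≠ 0))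
  set d : M := ⟨δ, hδM⟩ with hdd
  have hd0 : d ≠ 0 := by
    intro hh
    exact hd (by simpa [hdd] using congrArg (fun t : M => (t : F)) hh)
  -- gaps along the line `x + ℤ δ`
  have hgap : ∀ k : ℤ, x + k • d ∉ S → ∃ N : ℕ,
      2 * (a + x) + κ = N * (k * δ) + κ * δ * (k ^ 2 * δ) := by
    intro k hk
    have hk0 : k ≠ 0 := by
      rintro rfl
      simp at hk
      exact hk hx
    have hkd : k • d ≠ 0 := by simp [hk0, hd0]
    rcases h.gap x (k • d) hkd hx hk with ⟨N, hN⟩ | ⟨h0, -⟩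
    · refine ⟨N, ?_⟩
      have hkd' : (k : F) * δ ≠ 0 := mul_ne_zero (by exact_mod_cast hk0) hd
      simp only [AddSubgroup.coe_zsmul, hdd, zsmul_eq_mul] at hN
      apply mul_left_cancel₀ hkd'
      linear_combination hN
    · exact absurd h0 hκ
  -- A half line in the support would give `κ = 0`, so gaps occur arbitrarily far out in both
  -- directions.
  have hpos : ∀ k0 : ℕ, ∃ k : ℕ, k0 ≤ k ∧ x + (k : ℤ) • d ∉ S := by
    intro k0
    by_contra hcon
    push Not at hcon
    refine hκ (h.ray (x + k0 • d) d hd0 fun n => ?_).1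
    have := hcon (k0 + n) (by omega)
    simpa [add_nsmul, add_smul, add_assoc] using this
  have hneg : ∀ k0 : ℕ, ∃ k : ℕ, k0 ≤ k ∧ x + (-(k : ℤ)) • d ∉ S := by
    intro k0
    by_contra hcon
    push Not at hcon
    refine hκ (h.ray (x + k0 • (-d)) (-d) (by simpa using hd0) fun n => ?_).1
    have := hcon (k0 + n) (by omega)
    convert this using 1
    simp only [add_nsmul, smul_neg, neg_smul, natCast_zsmul]
    abel
  obtain ⟨k, hk1, hk⟩ := hpos 1
  obtain ⟨l, hl1, hl⟩ := hpos (k + 1)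
  obtain ⟨N, hN⟩ := hgap _ hk
  obtain ⟨N', hN'⟩ := hgap _ hl
  have hlk : ((l : ℚ) ^ 2 - k ^ 2) ≠ 0 := by
    have : (k : ℚ) < l := by exact_mod_cast hl1
    have h1 : (1 : ℚ) ≤ k := by exact_mod_cast hk1
    nlinarith
  have hlkF : ((l : F) ^ 2 - k ^ 2) ≠ 0 := by exact_mod_cast hlk
  -- Two gaps show that `κ * δ` and `(2 * (a + x) + κ) / δ` are rational numbers `r` and `q`. Every
  -- gap `j` then satisfies `N * j + r * j ^ 2 = q` with `N ≥ 0`, which fails far out on the side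
  -- where `j` has the sign of `r`.
  set r : ℚ := (N * k - N' * l) / (l ^ 2 - k ^ 2) with hr
  have hrF : (r : F) = κ * δ := by
    rw [hr]
    push_cast
    rw [div_eq_iff hlkF]
    push_cast at hN hN'
    apply mul_left_cancel₀ hd
    linear_combination hN' - hN
  set q : ℚ := N * k + r * k ^ 2 with hq
  have hqF : (q : F) * δ = 2 * (a + x) + κ := by
    rw [hN, hq]
    push_cast
    rw [hrF]
    ring
  have hall : ∀ j : ℤ, x + j • d ∉ S → ∃ N : ℕ, (N : ℚ) * j + r * j ^ 2 = q := by
    intro j hj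
    obtain ⟨N, hN⟩ := hgap j hj
    refine ⟨N, ?_⟩
    have : (((N : ℚ) * j + r * j ^ 2 : ℚ) : F) = q := by
      apply mul_right_cancel₀ hd
      rw [hqF, hN]
      push_cast
      rw [hrF]
      ring
    exact_mod_cast this
  have hr0 : r ≠ 0 := by
    intro h0
    rw [h0] at hrF
    have := hrF.symm
    simp [hκ, hd] at this
  obtain ⟨B, hB⟩ := exists_nat_gt (|q| / |r| + 1)
  have hrpos : 0 < |r| := abs_pos.2 hr0
  have hbig : ∀ j : ℕ, B ≤ j → |q| < |r| * j ^ 2 := by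
    intro j hj
    have h1 : |q| / |r| + 1 < j := hB.trans_le (by exact_mod_cast hj)
    have h0 : 0 ≤ |q| / |r| := by positivity
    have h2 : |q| / |r| < j ^ 2 := by nlinarith
    rw [div_lt_iff₀ hrpos] at h2
    linarith
  rcases lt_or_gt_of_ne hr0 with hneg' | hpos'
  · obtain ⟨j, hj, hjS⟩ := hneg B
    obtain ⟨N, hN⟩ := hall _ hjS
    have h1 := hbig j hj
    rw [abs_of_neg hneg'] at h1
    have h2 := neg_abs_le q
    push_cast at hN
    have h3 : (0 : ℚ) ≤ N * j := by positivity
    nlinarith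
  · obtain ⟨j, hj, hjS⟩ := hpos B
    obtain ⟨N, hN⟩ := hall _ hjS
    have h1 := hbig j hj
    rw [abs_of_pos hpos'] at h1
    have h2 := le_abs_self q
    push_cast at hN
    have h3 : (0 : ℚ) ≤ N * j := by positivity
    nlinarith

/-- If a nonzero weight is missing, then every weight of the support vanishes. -/
theorem EdgeRel.support (h : EdgeRel a S 0 e) {m x : M} (hm : m ∉ S) (hm0 : a + (m : F) ≠ 0)
    (hx : x ∈ S) : a + (x : F) = 0 := by
  by_contra hx0
  set δ : M := m - x with hδ
  have hδ0 : δ ≠ 0 := by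
    intro h0
    rw [hδ, sub_eq_zero] at h0
    exact hm (h0 ▸ hx)
  have hd : (δ : F) ≠ 0 := by simpa using hδ0
  have hxm : x + δ = m := by rw [hδ]; abel
  rcases h.gap x δ hδ0 hx (by rwa [hxm]) with ⟨N, hN⟩ | ⟨-, h0⟩
  swap
  · rw [hxm] at h0; exact hm0 h0
  have hN' : 2 * (a + (x : F)) = N * δ := by
    apply mul_left_cancel₀ hd
    linear_combination hN
  have hweight : ∀ k : ℕ, 2 * (a + ((x + k • δ : M) : F)) = (N + 2 * k) * δ := by
    intro k
    push_cast
    simp only [nsmul_eq_mul]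
    linear_combination hN'
  have hNpos : 0 < N := by
    rcases Nat.eq_zero_or_pos N with h0 | h0
    · rw [h0] at hN'; simp at hN'; exact absurd hN' hx0
    · exact h0
  -- Stepping back to `m` from a point of the support beyond it would give `N + 2 * k + N' * (k - 1)
  -- = 0` in natural numbers.
  have hmiss : ∀ k : ℕ, 1 ≤ k → x + k • δ ∉ S := by
    intro k hk hmem
    rcases Nat.eq_or_lt_of_le hk with rfl | hk2
    · rw [one_nsmul, hxm] at hmem; exact hm hmem
    obtain ⟨j, rfl⟩ : ∃ j, k = j + 2 := ⟨k - 2, by omega⟩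
    have e1 : x + (j + 2) • δ + (-((j + 1) • δ)) = m := by
      rw [← hxm]; simp only [add_nsmul, two_nsmul, one_nsmul]; abel
    have hne : -((j + 1) • δ) ≠ 0 := by
      rw [neg_ne_zero]; exact smul_ne_zero (by omega) hδ0
    rcases h.gap _ _ hne hmem (by rwa [e1]) with ⟨N', h1⟩ | ⟨-, h0⟩
    · have h2 := hweight (j + 2)
      push_cast at h1 h2
      simp only [nsmul_eq_mul] at h1 h2
      push_cast at h1 h2
      have h3 : (N + 2 * (j + 2) : F) + N' * (j + 1) = 0 := by
        have h4 : (j + 1 : F) * δ ^ 2 ≠ 0 :=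
          mul_ne_zero (by exact_mod_cast Nat.succ_ne_zero j) (pow_ne_zero 2 hd)
        apply mul_left_cancel₀ h4
        linear_combination -h1 - (j + 1 : F) * δ * h2
      have h4 : N + 2 * (j + 2) + N' * (j + 1) = 0 := by exact_mod_cast h3
      omega
    · rw [e1] at h0; exact hm0 h0
  -- With this step the gap condition would make `N + 1` divide the positive number `N`.
  rcases h.gap x ((N + 1) • δ) (smul_ne_zero (by omega) hδ0) hx (hmiss _ (by omega)) with
    ⟨N', h1⟩ | ⟨-, h0⟩
  · push_cast at h1
    simp only [nsmul_eq_mul] at h1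
    push_cast at h1
    have h2 : (N : F) = N' * (N + 1) := by
      have h4 : (N + 1 : F) * δ ^ 2 ≠ 0 :=
        mul_ne_zero (by exact_mod_cast Nat.succ_ne_zero N) (pow_ne_zero 2 hd)
      apply mul_left_cancel₀ h4
      linear_combination h1 - (N + 1 : F) * δ * hN'
    have h3 : N = N' * (N + 1) := by exact_mod_cast h2
    rcases Nat.eq_zero_or_pos N' with h0 | h0
    · rw [h0] at h3; omega
    · nlinarith
  · have h2 := hweight (N + 1)
    rw [h0, mul_zero] at h2
    have h3 : (N + 2 * ((N + 1 : ℕ) : F)) = 0 := by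
      rcases mul_eq_zero.1 h2.symm with h' | h'
      · exact h'
      · exact absurd h' hd
    have h4 : N + 2 * (N + 1) = 0 := by exact_mod_cast h3
    omega

end Support


/-! ### Sequences attached to two families of parallel lines -/

section QuadraticSequences

variable {F : Type*} [Field F] [CharZero F]

theorem quadratic_coeff_eq_zero (c0 c1 c2 : F)
    (h : ∀ i : ℤ, c2 * (i : F) ^ 2 + c1 * i + c0 = 0) : c2 = 0 := by
  have h0 := h 0
  have h1 := h 1
  have h2 := h (-1)
  push_cast at h0 h1 h2
  have : (2 : F) * c2 = 0 := by linear_combination h1 + h2 - 2 * h0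
  simpa using this

omit [CharZero F] in
theorem eq_quadratic_of_second_difference (f : ℤ → F) (C : F)
    (h : ∀ j, f (j + 1) - 2 * f j + f (j - 1) = 2 * C) :
    ∃ B, ∀ j : ℤ, f j = f 0 + B * j + C * j ^ 2 := by
  refine ⟨f 1 - f 0 - C, ?_⟩
  have h2 : ∀ n : ℕ, (f n = f 0 + (f 1 - f 0 - C) * n + C * n ^ 2 ∧
      f (n + 1 : ℤ) = f 0 + (f 1 - f 0 - C) * (n + 1) + C * (n + 1) ^ 2) ∧
      (f (-n) = f 0 + (f 1 - f 0 - C) * (-n) + C * (-n) ^ 2 ∧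
      f (-n - 1 : ℤ) = f 0 + (f 1 - f 0 - C) * (-n - 1) + C * (-n - 1) ^ 2) := by
    intro n
    induction n with
    | zero =>
      refine ⟨⟨by simp, by simp; ring⟩, by simp, ?_⟩
      have := h 0
      simp only [zero_add, zero_sub] at this
      simp only [Nat.cast_zero, neg_zero, zero_sub]
      linear_combination this
    | succ n ih =>
      obtain ⟨⟨h1, h2⟩, h3, h4⟩ := ih
      refine ⟨⟨by push_cast; exact h2, ?_⟩, ?_, ?_⟩
      · have := h (n + 1)
        rw [add_sub_cancel_right] at this
        push_cast
        linear_combination this + 2 * h2 - h1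
      · rw [show (-((n + 1 : ℕ) : ℤ)) = -n - 1 by push_cast; ring, h4]
        push_cast; ring
      · have := h (-n - 1)
        rw [sub_add_cancel] at this
        rw [show (-((n + 1 : ℕ) : ℤ)) - 1 = -n - 1 - 1 by push_cast; ring]
        push_cast
        linear_combination this + 2 * h4 - h3
  intro j
  obtain ⟨n, rfl | rfl⟩ := j.eq_nat_or_neg
  · simpa using (h2 n).1.1
  · simpa using (h2 n).2.1

/-- The relation between the normalised constants on two families of parallel lines. -/
def LineRel (p0 m n : F) (f g : ℤ → F) : Prop := ∀ i j : ℤ, ∀ p : F, p = p0 + i * m + j * n →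
  p ^ 2 * (m ^ 2 * (f (j + 1) - 2 * f j + f (j - 1)) - n ^ 2 * (g (i + 1) - 2 * g i + g (i - 1))) +
  p * (n * m ^ 2 * (f (j + 1) - f (j - 1)) - m * n ^ 2 * (g (i + 1) - g (i - 1))) +
  4 * m ^ 2 * n ^ 2 * (g i - f j) +
  m ^ 2 * n ^ 2 * (g i * (f (j + 1) - 2 * f j + f (j - 1)) -
    f j * (g (i + 1) - 2 * g i + g (i - 1))) = 0

/-- The relation between the normalised constants, with one of the steps doubled. -/
def LineRelTwo (p0 m n : F) (f g : ℤ → F) : Prop := ∀ i j : ℤ, ∀ p : F, p = p0 + i * m + j * n →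
  p ^ 2 * (m ^ 2 * (f (j + 2) - 2 * f j + f (j - 2)) -
    4 * n ^ 2 * (g (i + 1) - 2 * g i + g (i - 1))) +
  p * (2 * n * m ^ 2 * (f (j + 2) - f (j - 2)) - 4 * m * n ^ 2 * (g (i + 1) - g (i - 1))) +
  16 * m ^ 2 * n ^ 2 * (g i - f j) +
  4 * m ^ 2 * n ^ 2 * (g i * (f (j + 2) - 2 * f j + f (j - 2)) -
    f j * (g (i + 1) - 2 * g i + g (i - 1))) = 0

omit [CharZero F] in
theorem LineRel.symm {p0 m n : F} {f g : ℤ → F} (h : LineRel p0 m n f g) :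
    LineRel p0 n m g f := by
  intro i j p hp
  linear_combination -h j i p (by rw [hp]; ring)

/-- Subtracting four times the original relation from the doubled one removes the differences of `g`
and leaves `g i` against a quadratic in `i`. Either this shows at once that `f` has zero second
difference, or `g` is quadratic; substituting back then makes the second difference of `f` constant.
A nonzero constant would force `g = 0`, which the original relation excludes. -/
theorem LineRel.affine {p0 m n : F} {f g : ℤ → F} (hm : m ≠ 0) (hn : n ≠ 0)
    (h1 : LineRel p0 m n f g) (h2 : LineRelTwo p0 m n f g) :
    ∃ B, ∀ j : ℤ, f j = f 0 + B * j := by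
  have hdiff : ∀ i j : ℤ, ∀ p : F, p = p0 + i * m + j * n →
      p ^ 2 * ((f (j + 2) - 2 * f j + f (j - 2)) - 4 * (f (j + 1) - 2 * f j + f (j - 1))) +
      p * (2 * n * ((f (j + 2) - f (j - 2)) - 2 * (f (j + 1) - f (j - 1)))) +
      4 * n ^ 2 * g i * ((f (j + 2) - 2 * f j + f (j - 2)) - (f (j + 1) - 2 * f j + f (j - 1)))
        = 0 := by
    intro i j p hp
    apply mul_left_cancel₀ (pow_ne_zero 2 hm)
    linear_combination h2 i j p hp - 4 * h1 i j p hp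
  have hconst : ∃ C, ∀ j, f (j + 1) - 2 * f j + f (j - 1) = 2 * C := by
    by_cases hγ : ∀ j, (f (j + 2) - 2 * f j + f (j - 2)) - (f (j + 1) - 2 * f j + f (j - 1)) = 0
    · refine ⟨0, fun j => ?_⟩
      set A := (f (j + 2) - 2 * f j + f (j - 2)) - 4 * (f (j + 1) - 2 * f j + f (j - 1)) with hA
      set B := 2 * n * ((f (j + 2) - f (j - 2)) - 2 * (f (j + 1) - f (j - 1))) with hB
      have := quadratic_coeff_eq_zero ((p0 + j * n) ^ 2 * A + (p0 + j * n) * B)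
        (2 * (p0 + j * n) * m * A + m * B) (m ^ 2 * A) (fun i => by
          linear_combination hdiff i j _ rfl - 4 * n ^ 2 * g i * hγ j)
      have hA0 : A = 0 := by simpa [hm] using this
      have h3 : (3 : F) * (f (j + 1) - 2 * f j + f (j - 1)) = 0 := by
        linear_combination hγ j - hA0
      simpa using h3
    · push Not at hγ
      obtain ⟨j0, hj0⟩ := hγ
      set γ := 4 * n ^ 2 *
        ((f (j0 + 2) - 2 * f j0 + f (j0 - 2)) - (f (j0 + 1) - 2 * f j0 + f (j0 - 1))) with hγ
      have hγ0 : γ ≠ 0 := mul_ne_zero (mul_ne_zero (by norm_num) (pow_ne_zero 2 hn)) hj0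
      set A := (f (j0 + 2) - 2 * f j0 + f (j0 - 2)) - 4 * (f (j0 + 1) - 2 * f j0 + f (j0 - 1))
        with hA
      set B := 2 * n * ((f (j0 + 2) - f (j0 - 2)) - 2 * (f (j0 + 1) - f (j0 - 1))) with hB
      obtain ⟨c0, c1, c2, hg⟩ : ∃ c0 c1 c2 : F, ∀ i : ℤ, g i = c2 * i ^ 2 + c1 * i + c0 := by
        refine ⟨-((p0 + j0 * n) ^ 2 * A + (p0 + j0 * n) * B) / γ,
          -(2 * (p0 + j0 * n) * m * A + m * B) / γ, -(m ^ 2 * A) / γ, fun i => ?_⟩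
        field_simp
        linear_combination hdiff i j0 _ rfl
      have hj : ∀ j, (f (j + 1) - 2 * f j + f (j - 1)) * (m ^ 2 + n ^ 2 * c2) =
          2 * n ^ 2 * c2 := by
        intro j
        set Δ := f (j + 1) - 2 * f j + f (j - 1) with hΔ
        set E := f (j + 1) - f (j - 1) with hE
        set q := p0 + j * n with hq
        have := quadratic_coeff_eq_zero
          (q ^ 2 * (m ^ 2 * Δ - 2 * n ^ 2 * c2) + q * (n * m ^ 2 * E - m * n ^ 2 * (2 * c1)) +
            4 * m ^ 2 * n ^ 2 * (c0 - f j) + m ^ 2 * n ^ 2 * (c0 * Δ - f j * (2 * c2)))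
          (2 * q * m * (m ^ 2 * Δ - 2 * n ^ 2 * c2) + m * (n * m ^ 2 * E - m * n ^ 2 * (2 * c1)) -
            q * m * n ^ 2 * (4 * c2) + 4 * m ^ 2 * n ^ 2 * c1 + m ^ 2 * n ^ 2 * (c1 * Δ))
          (m ^ 2 * (m ^ 2 * Δ - 2 * n ^ 2 * c2) - m * m * n ^ 2 * (4 * c2) +
            4 * m ^ 2 * n ^ 2 * c2 + m ^ 2 * n ^ 2 * (c2 * Δ)) (fun i => by
          have := h1 i j _ rfl
          rw [hg, hg, hg] at this
          push_cast at this
          linear_combination this)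
        apply mul_left_cancel₀ (pow_ne_zero 2 hm)
        linear_combination this
      have hne : m ^ 2 + n ^ 2 * c2 ≠ 0 := by
        intro h0
        have := hj 0
        rw [h0, mul_zero] at this
        have hc : n ^ 2 * c2 = 0 := by linear_combination (-1 / 2 : F) * this
        rw [hc, add_zero] at h0
        exact pow_ne_zero 2 hm h0
      refine ⟨n ^ 2 * c2 / (m ^ 2 + n ^ 2 * c2), fun j => ?_⟩
      rw [← mul_div_assoc, eq_div_iff hne]
      linear_combination hj j
  obtain ⟨C, hC⟩ := hconst
  obtain ⟨B, hB⟩ := eq_quadratic_of_second_difference f C hC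
  suffices hC0 : C = 0 by
    refine ⟨B, fun j => ?_⟩
    rw [hB j, hC0]; ring
  by_contra hC0
  have hg : ∀ i, g i = 0 := by
    intro i
    have := hdiff i 0 _ rfl
    rw [hB (0 + 2), hB (0 - 2), hB (0 + 1), hB (0 - 1)] at this
    push_cast at this
    have h3 : 24 * n ^ 2 * C * g i = 0 := by linear_combination this
    simpa [hn, hC0] using h3
  have := quadratic_coeff_eq_zero (p0 ^ 2 * (m ^ 2 * (2 * C)) + p0 * (n * m ^ 2 * (2 * B)) -
      4 * m ^ 2 * n ^ 2 * f 0) (2 * p0 * m * (m ^ 2 * (2 * C)) + m * (n * m ^ 2 * (2 * B)))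
      (m ^ 2 * (m ^ 2 * (2 * C))) (fun i => by
    have := h1 i 0 _ rfl
    rw [hg, hg, hg, hB (0 + 1), hB (0 - 1)] at this
    push_cast at this
    linear_combination this)
  simp [hm, hC0] at this

theorem LineRel.slope {p0 m n : F} {f g : ℤ → F} (hm : m ≠ 0) (hn : n ≠ 0)
    (h : LineRel p0 m n f g) (h2 : LineRelTwo p0 m n f g) (h3 : LineRelTwo p0 n m g f) :
    (∀ j : ℤ, f j = f 0 + (f 1 - f 0) * j) ∧ n * (g 0 - f 0) = -(f 1 - f 0) * p0 := by
  obtain ⟨B, hB⟩ := h.affine hm hn h2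
  obtain ⟨B', hB'⟩ := h.symm.affine hn hm h3
  have hB1 : f 1 - f 0 = B := by rw [hB 1]; simp
  refine ⟨by rw [hB1]; exact hB, ?_⟩
  rw [hB1]
  have key : ∀ i : ℤ, (p0 + i * m) * (m * B - n * B') + 2 * m * n * (g 0 - f 0 + B' * i) = 0 := by
    intro i
    have := h i 0 _ rfl
    rw [hB (0 + 1), hB (0 - 1), hB' (i + 1), hB' (i - 1), hB' i] at this
    push_cast at this
    have h2 : 2 * m * n ≠ 0 := mul_ne_zero (mul_ne_zero two_ne_zero hm) hn
    apply mul_left_cancel₀ h2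
    linear_combination this
  have k0 := key 0
  have k1 := key 1
  push_cast at k0 k1
  have h4 : m * B + n * B' = 0 := by
    apply mul_left_cancel₀ hm
    linear_combination k1 - k0
  have h5 : 2 * m ≠ 0 := mul_ne_zero two_ne_zero hm
  apply mul_left_cancel₀ h5
  linear_combination k0 + p0 * h4

end QuadraticSequences

/-! ### Determination of all round trips -/

section RoundTrips

variable {F : Type*} [Field F] {M : AddSubgroup F} {a : F} {e : M → M → F}

/-- The relations without exceptional pairs of points. -/
structure FullEdgeRel (a : F) (e : M → M → F) : Prop where
  rel : ∀ x y z y' : M, y + y' = x + z →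
    e x y * e y z - e x y' * e y' z = ((y : F) - y') * e x z
  self : ∀ x : M, e x x = a + x

theorem EdgeRel.full (h : EdgeRel a Set.univ 0 e) (hself : ∀ x : M, e x x = a + x) :
    FullEdgeRel a e := by
  refine ⟨fun x y z y' hy => ?_, hself⟩
  by_cases hxz : x = z
  · subst hxz
    have h1 := h.rel_self x trivial (y - x)
    have e1 : x + (y - x) = y := by abel
    have e2 : x - (y - x) = y' := by rw [eq_sub_of_add_eq' hy]; abel
    have e3 : (y' : F) = x + x - y := by rw [eq_sub_of_add_eq' hy]; push_cast; ring
    rw [e1, e2] at h1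
    rw [hself, e3]
    simp only [roundTrip] at h1
    push_cast at h1
    linear_combination h1
  · exact h.rel x trivial z trivial hxz y y' hy

namespace FullEdgeRel

theorem edgeRel (h : FullEdgeRel a e) : EdgeRel a Set.univ 0 e where
  zero_left x y hx := absurd trivial hx
  zero_right x y hx := absurd trivial hx
  rel x _ z _ _ y y' hy := h.rel x y z y' hy
  rel_self x _ μ := by
    have := h.rel x (x + μ) x (x - μ) (by abel)
    rw [h.self] at this
    simp only [roundTrip]
    push_cast at this
    linear_combination this

theorem roundTrip_self (h : FullEdgeRel a e) (x : M) : roundTrip e x x = (a + x) * (a + x) := by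
  rw [roundTrip, h.self]

theorem roundTrip_step (h : FullEdgeRel a e) (x μ : M) :
    roundTrip e x (x + μ) = roundTrip e x (x - μ) + 2 * μ * (a + x) := by
  linear_combination h.edgeRel.rel_self x trivial μ

theorem triangle_reflect (h : FullEdgeRel a e) (x y z y' : M) (hy : y + y' = x + z) :
    triangle e x y z - triangle e x y' z = ((y : F) - y') * roundTrip e x z := by
  simp only [triangle, roundTrip]
  linear_combination e z x * h.rel x y z y' hy

theorem triangle_reflect' (h : FullEdgeRel a e) (x y z y' : M) (hy : y + y' = x + z) :
    triangle e x z y - triangle e x z y' = ((y : F) - y') * roundTrip e x z := by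
  simp only [triangle, roundTrip]
  linear_combination e x z * h.rel z y x y' (by rw [hy, add_comm])

/-- Round trips around a parallelogram. -/
theorem parallelogram (h : FullEdgeRel a e) (x y z y' : M) (hy : y + y' = x + z) :
    roundTrip e x y * roundTrip e y z - roundTrip e x y' * roundTrip e y' z =
      ((y : F) - y') * (triangle e x y z + triangle e x z y - ((y : F) - y') * roundTrip e x z) := by
  have h1 := h.rel x y z y' hy
  have h2 := h.rel z y x y' (by rw [hy, add_comm])
  simp only [triangle, roundTrip]
  linear_combination (e z y * e y x - ((y : F) - y') * e z x) * h1 + e x y' * e y' z * h2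

/-- The deviation of the round trips from those of `A_{a,0}`. -/
def deviation (a : F) (e : M → M → F) (μ p : M) : F :=
  roundTrip e p (p + μ) - (a + p) * (a + p + μ)

theorem roundTrip_eq (x y : M) : roundTrip e x y =
    (a + x) * (a + y) + deviation a e (y - x) x := by
  have : x + (y - x) = y := by abel
  rw [deviation, this]
  push_cast
  ring

/-- The subtracted product absorbs the step relation, so the deviation depends only on the line
through `p` in direction `μ`. -/
theorem deviation_add (h : FullEdgeRel a e) (μ p : M) :
    deviation a e μ (p + μ) = deviation a e μ p := by
  have := h.roundTrip_step (p + μ) μ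
  rw [add_sub_cancel_right, roundTrip_comm (p + μ) p] at this
  simp only [deviation, this]
  push_cast
  ring

theorem deviation_sub (h : FullEdgeRel a e) (μ p : M) :
    deviation a e μ (p - μ) = deviation a e μ p := by
  rw [← h.deviation_add μ (p - μ), sub_add_cancel]

theorem deviation_zsmul (h : FullEdgeRel a e) (μ p : M) (i : ℤ) :
    deviation a e μ (p + i • μ) = deviation a e μ p := by
  induction i with
  | zero => simp
  | succ i ih => rw [add_smul, one_smul, ← add_assoc, h.deviation_add, ih]
  | pred i ih => rw [sub_smul, one_smul, ← add_sub_assoc, h.deviation_sub, ih]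

theorem deviation_neg (h : FullEdgeRel a e) (μ p : M) :
    deviation a e (-μ) p = deviation a e μ p := by
  rw [← h.deviation_sub μ p]
  simp only [deviation, sub_add_cancel, ← sub_eq_add_neg]
  rw [roundTrip_comm]
  push_cast
  ring

theorem deviation_zero (h : FullEdgeRel a e) (p : M) : deviation a e 0 p = 0 := by
  simp [deviation, h.roundTrip_self]

/-- These are the constants `K` and `4 * K` of `EdgeRel.ray`; they supply the doubled-step relation
`LineRelTwo`. -/
theorem deviation_two [CharZero F] (h : FullEdgeRel a e) (μ p : M) :
    deviation a e (2 • μ) p = 4 * deviation a e μ p := by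
  by_cases hμ : μ = 0
  · simp [hμ, h.deviation_zero]
  obtain ⟨-, K, D, -, h1, h2, -⟩ := h.edgeRel.ray p μ hμ fun _ => trivial
  have k1 := h1 0
  have k2 := h2 0
  simp at k1 k2
  simp only [deviation, two_nsmul, AddSubgroup.coe_add] at *
  rw [k1, k2]
  ring

/-- The relation between the deviations on the lines of two directions around a point. -/
theorem deviation_rel (h : FullEdgeRel a e) (μ ν p : M) :
    (a + (p : F)) ^ 2 * ((deviation a e μ (p + ν) - 2 * deviation a e μ p +
        deviation a e μ (p - ν)) - (deviation a e ν (p + μ) - 2 * deviation a e ν p +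
        deviation a e ν (p - μ))) +
      (a + (p : F)) * (ν * (deviation a e μ (p + ν) - deviation a e μ (p - ν)) -
        μ * (deviation a e ν (p + μ) - deviation a e ν (p - μ))) +
      4 * ((μ : F) ^ 2 * deviation a e ν p - (ν : F) ^ 2 * deviation a e μ p) +
      (deviation a e ν p * (deviation a e μ (p + ν) - 2 * deviation a e μ p +
        deviation a e μ (p - ν)) - deviation a e μ p * (deviation a e ν (p + μ) -
        2 * deviation a e ν p + deviation a e ν (p - μ))) = 0 := by
  -- A parallelogram expresses the sum of the two orientations of a triangle by round trips. The
  -- triangles on opposite sides of `p` are joined by two reflections through the triangle `p, p +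
  -- ν, p - μ`; eliminating them leaves only deviations.
  have s1 := h.parallelogram p (p + ν) (p + μ + ν) (p + μ) (by abel)
  have s0 := h.parallelogram (p - μ - ν) (p - μ) p (p - ν) (by abel)
  have t1 := h.triangle_reflect' p (p + μ + ν) (p + ν) (p - μ) (by abel)
  have t1' := h.triangle_reflect p (p + μ + ν) (p + ν) (p - μ) (by abel)
  have t2 := h.triangle_reflect (p - μ) (p + ν) p (p - μ - ν) (by abel)
  have t2' := h.triangle_reflect' (p - μ) (p + ν) p (p - μ - ν) (by abel)
  rw [triangle_rotate p (p + ν) (p - μ), triangle_rotate (p + ν) (p - μ) p] at t1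
  rw [triangle_rotate p (p - μ) (p + ν)] at t1'
  rw [triangle_rotate (p - μ - ν) (p - μ) p, triangle_rotate (p - μ - ν) p (p - μ),
    triangle_rotate p (p - μ) (p - μ - ν)] at s0
  have d1 : roundTrip e p (p + ν) = _ := roundTrip_eq (a := a) p (p + ν)
  have d2 : roundTrip e (p + ν) (p + μ + ν) = _ := roundTrip_eq (a := a) (p + ν) (p + μ + ν)
  have d3 : roundTrip e p (p + μ) = _ := roundTrip_eq (a := a) p (p + μ)
  have d4 : roundTrip e (p + μ) (p + μ + ν) = _ := roundTrip_eq (a := a) (p + μ) (p + μ + ν)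
  have d5 : roundTrip e (p - μ - ν) (p - μ) = _ := roundTrip_eq (a := a) (p - μ - ν) (p - μ)
  have d6 : roundTrip e (p - μ) p = _ := roundTrip_eq (a := a) (p - μ) p
  have d7 : roundTrip e (p - μ - ν) (p - ν) = _ := roundTrip_eq (a := a) (p - μ - ν) (p - ν)
  have d8 : roundTrip e (p - ν) p = _ := roundTrip_eq (a := a) (p - ν) p
  have d9 : roundTrip e p (p + μ + ν) = _ := roundTrip_eq (a := a) p (p + μ + ν)
  have d10 : roundTrip e (p - μ - ν) p = _ := roundTrip_eq (a := a) (p - μ - ν) p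
  rw [show p + ν - p = ν by abel] at d1
  rw [show p + μ + ν - (p + ν) = μ by abel] at d2
  rw [show p + μ - p = μ by abel] at d3
  rw [show p + μ + ν - (p + μ) = ν by abel] at d4
  rw [show p - μ - (p - μ - ν) = ν by abel, h.deviation_sub] at d5
  rw [show p - (p - μ) = μ by abel, h.deviation_sub] at d6
  rw [show p - ν - (p - μ - ν) = μ by abel, show p - μ - ν = p - ν - μ by abel,
    h.deviation_sub] at d7
  rw [show p - (p - ν) = ν by abel, h.deviation_sub] at d8
  rw [show p + μ + ν - p = μ + ν by abel] at d9
  rw [show p - (p - μ - ν) = μ + ν by abel, show p - μ - ν = p - (μ + ν) by abel,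
    h.deviation_sub] at d10
  rw [show p - (μ + ν) = p - μ - ν by abel] at d10
  rw [show p - ν - μ = p - μ - ν by abel] at d7
  rw [d1, d2, d3, d4, d9] at s1
  rw [d5, d6, d7, d8, d10] at s0
  rw [d1] at t1 t1'
  rw [d6] at t2 t2'
  push_cast at *
  linear_combination s1 - s0 + ((ν : F) - μ) * (t1 + t1' + t2 + t2')

/-- Two parallelograms with a common triangle. -/
theorem deviation_rel' (h : FullEdgeRel a e) (μ ν p : M) (w P1 P2 P3 P4 P5 P6 P7 : F)
    (hw : w = a + p)
    (h1 : P1 = w * (w + ν) + deviation a e ν p)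
    (h2 : P2 = (w + ν) * (w + μ + ν) + deviation a e μ (p + ν))
    (h3 : P3 = w * (w + μ) + deviation a e μ p)
    (h4 : P4 = (w + μ) * (w + μ + ν) + deviation a e ν (p + μ))
    (h5 : P5 = w * (w + μ + ν) + deviation a e (μ + ν) p)
    (h6 : P6 = (w + ν) * (w - μ) + deviation a e (μ + ν) (p - μ))
    (h7 : P7 = w * (w - μ) + deviation a e μ p) :
    (2 * (μ : F) + ν) * (P1 * P2 - P3 * P4 + (ν - μ) ^ 2 * P5) =
      (ν - μ) * (P2 * P5 - P6 * P7 + (2 * μ + ν) ^ 2 * P1) := by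
  have s1 := h.parallelogram p (p + ν) (p + μ + ν) (p + μ) (by abel)
  have s2 := h.parallelogram (p + ν) (p + μ + ν) p (p - μ) (by abel)
  rw [← triangle_rotate p (p + ν), triangle_rotate (p + ν) p] at s2
  have d1 : roundTrip e p (p + ν) = _ := roundTrip_eq (a := a) p (p + ν)
  have d2 : roundTrip e (p + ν) (p + μ + ν) = _ := roundTrip_eq (a := a) (p + ν) (p + μ + ν)
  have d3 : roundTrip e p (p + μ) = _ := roundTrip_eq (a := a) p (p + μ)
  have d4 : roundTrip e (p + μ) (p + μ + ν) = _ := roundTrip_eq (a := a) (p + μ) (p + μ + ν)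
  have d5 : roundTrip e p (p + μ + ν) = _ := roundTrip_eq (a := a) p (p + μ + ν)
  have d6 : roundTrip e (p - μ) (p + ν) = _ := roundTrip_eq (a := a) (p - μ) (p + ν)
  have d7 : roundTrip e (p - μ) p = _ := roundTrip_eq (a := a) (p - μ) p
  rw [show p + ν - p = ν by abel] at d1
  rw [show p + μ + ν - (p + ν) = μ by abel] at d2
  rw [show p + μ - p = μ by abel] at d3
  rw [show p + μ + ν - (p + μ) = ν by abel] at d4
  rw [show p + μ + ν - p = μ + ν by abel] at d5
  rw [show p + ν - (p - μ) = μ + ν by abel] at d6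
  rw [show p - (p - μ) = μ by abel, h.deviation_sub] at d7
  push_cast at *
  have e1 : roundTrip e p (p + ν) = P1 := by rw [d1, h1, hw]; ring
  have e2 : roundTrip e (p + ν) (p + μ + ν) = P2 := by rw [d2, h2, hw]; ring
  have e3 : roundTrip e p (p + μ) = P3 := by rw [d3, h3, hw]; ring
  have e4 : roundTrip e (p + μ) (p + μ + ν) = P4 := by rw [d4, h4, hw]; ring
  have e5 : roundTrip e p (p + μ + ν) = P5 := by rw [d5, h5, hw]; ring
  have e6 : roundTrip e (p - μ) (p + ν) = P6 := by rw [d6, h6, hw]; ring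
  have e7 : roundTrip e (p - μ) p = P7 := by rw [d7, h7, hw]; ring
  rw [e1, e2, e3, e4, e5] at s1
  rw [roundTrip_comm (p + μ + ν) p, roundTrip_comm (p + ν) (p - μ), roundTrip_comm (p + ν) p,
    e2, e5, e6, e7, e1] at s2
  linear_combination (2 * (μ : F) + ν) * s1 - ((ν : F) - μ) * s2

variable [CharZero F]

/-- The deviation is affine across the lines of a direction. -/
theorem deviation_slope (h : FullEdgeRel a e) (μ ν p : M) (hμ : (μ : F) ≠ 0) (hν : (ν : F) ≠ 0) :
    (ν : F) * (deviation a e ν p / (ν : F) ^ 2 - deviation a e μ p / (μ : F) ^ 2) =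
      -(deviation a e μ (p + ν) / (μ : F) ^ 2 - deviation a e μ p / (μ : F) ^ 2) * (a + p) ∧
    deviation a e μ (p - ν) - deviation a e μ p =
      -(deviation a e μ (p + ν) - deviation a e μ p) := by
  -- The normalisation makes both families constant with value `b * (1 - b)` in the case of
  -- `A_{a,b}`.
  have one : ∀ μ ν : M, (μ : F) ≠ 0 → (ν : F) ≠ 0 → LineRel (a + (p : F)) μ ν
      (fun j => deviation a e μ (p + j • ν) / (μ : F) ^ 2)
      (fun i => deviation a e ν (p + i • μ) / (ν : F) ^ 2) := by
    intro μ ν hμ hν i j q hq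
    have := h.deviation_rel μ ν (p + i • μ + j • ν)
    have e1 : p + i • μ + j • ν + ν = p + (j + 1) • ν + i • μ := by
      rw [add_smul, one_smul]; abel
    have e2 : p + i • μ + j • ν - ν = p + (j - 1) • ν + i • μ := by
      rw [sub_smul, one_smul]; abel
    have e3 : p + i • μ + j • ν + μ = p + (i + 1) • μ + j • ν := by
      rw [add_smul, one_smul]; abel
    have e4 : p + i • μ + j • ν - μ = p + (i - 1) • μ + j • ν := by
      rw [sub_smul, one_smul]; abel
    have e5 : a + ((p + i • μ + j • ν : M) : F) = q := by rw [hq]; simp [add_assoc]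
    have e6 : deviation a e μ (p + i • μ + j • ν) = deviation a e μ (p + j • ν) := by
      rw [show p + i • μ + j • ν = p + j • ν + i • μ by abel, h.deviation_zsmul]
    rw [e1, e2, e3, e4, e5, e6] at this
    simp only [h.deviation_zsmul] at this
    field_simp
    linear_combination this
  have two : ∀ μ ν : M, (μ : F) ≠ 0 → (ν : F) ≠ 0 → LineRelTwo (a + (p : F)) μ ν
      (fun j => deviation a e μ (p + j • ν) / (μ : F) ^ 2)
      (fun i => deviation a e ν (p + i • μ) / (ν : F) ^ 2) := by
    intro μ ν hμ hν i j q hq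
    have := h.deviation_rel μ (2 • ν) (p + i • μ + j • ν)
    have e1 : p + i • μ + j • ν + 2 • ν = p + (j + 2) • ν + i • μ := by
      rw [add_smul, two_smul, two_smul]; abel
    have e2 : p + i • μ + j • ν - 2 • ν = p + (j - 2) • ν + i • μ := by
      rw [sub_smul, two_smul, two_smul]; abel
    have e3 : p + i • μ + j • ν + μ = p + (i + 1) • μ + j • ν := by
      rw [add_smul, one_smul]; abel
    have e4 : p + i • μ + j • ν - μ = p + (i - 1) • μ + j • ν := by
      rw [sub_smul, one_smul]; abel
    have e5 : a + ((p + i • μ + j • ν : M) : F) = q := by rw [hq]; simp [add_assoc]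
    have e6 : deviation a e μ (p + i • μ + j • ν) = deviation a e μ (p + j • ν) := by
      rw [show p + i • μ + j • ν = p + j • ν + i • μ by abel, h.deviation_zsmul]
    have e7 : ((2 • ν : M) : F) = 2 * ν := by simp
    simp only [h.deviation_two] at this
    rw [e1, e2, e3, e4, e5, e6, e7] at this
    simp only [h.deviation_zsmul] at this
    field_simp
    linear_combination this
  obtain ⟨h1, h2⟩ := (one μ ν hμ hν).slope hμ hν (two μ ν hμ hν) (two ν μ hν hμ)
  simp only [zero_smul, add_zero, one_smul] at h1 h2
  refine ⟨h2, ?_⟩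
  have := h1 (-1)
  simp only [neg_smul, one_smul, ← sub_eq_add_neg] at this
  push_cast at this
  field_simp at this
  linear_combination this

/-- The deviation is constant across the lines of a direction. -/
theorem deviation_translate (h : FullEdgeRel a e) (μ ν p : M) (hμ : (μ : F) ≠ 0)
    (hν : (ν : F) ≠ 0) (hμν : (μ : F) + ν ≠ 0) (hμν2 : (μ : F) + 2 * ν ≠ 0) :
    deviation a e μ (p + ν) = deviation a e μ p := by
  set k : F := deviation a e μ p / (μ : F) ^ 2 with hk
  set B : F := deviation a e μ (p + ν) / (μ : F) ^ 2 - k with hB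
  have dk : deviation a e μ p = k * (μ : F) ^ 2 := by rw [hk]; field_simp
  have dB : deviation a e μ (p + ν) = (k + B) * (μ : F) ^ 2 := by rw [hB]; field_simp; ring
  -- A slope `B` in direction `ν` forces the deviations in the directions `ν` and `μ + ν` to be
  -- linear in the weight.
  have key : ∀ q : M, deviation a e μ q = k * (μ : F) ^ 2 →
      deviation a e μ (q + ν) = (k + B) * (μ : F) ^ 2 →
      deviation a e ν q = k * (ν : F) ^ 2 - B * ν * (a + q) ∧
      deviation a e (μ + ν) q = k * ((μ : F) + ν) ^ 2 - B * (μ + ν) * (a + q) := by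
    intro q h1 h2
    constructor
    · have := (h.deviation_slope μ ν q hμ hν).1
      rw [h1, h2] at this
      field_simp at this
      linear_combination this
    · have hs : ((μ + ν : M) : F) ≠ 0 := by simpa using hμν
      have := (h.deviation_slope μ (μ + ν) q hμ hs).1
      rw [show q + (μ + ν) = q + ν + μ by abel, h.deviation_add, h1, h2] at this
      push_cast at this
      field_simp at this
      linear_combination this
  have shift : ∀ q : M, deviation a e μ (q + μ + ν) = deviation a e μ (q + ν) := fun q => by
    rw [add_right_comm, h.deviation_add]
  have base : ∀ q : M, deviation a e μ q = k * (μ : F) ^ 2 →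
      deviation a e μ (q + ν) = (k + B) * (μ : F) ^ 2 → ∀ w : F, w = a + q →
      (2 * (μ : F) + ν) * ((w * (w + ν) + (k * (ν : F) ^ 2 - B * ν * w)) *
        ((w + ν) * (w + μ + ν) + (k + B) * (μ : F) ^ 2) -
        (w * (w + μ) + k * (μ : F) ^ 2) * ((w + μ) * (w + μ + ν) +
          (k * (ν : F) ^ 2 - B * ν * (w + μ))) + (ν - μ) ^ 2 * (w * (w + μ + ν) +
          (k * ((μ : F) + ν) ^ 2 - B * (μ + ν) * w))) =
      (ν - μ) * (((w + ν) * (w + μ + ν) + (k + B) * (μ : F) ^ 2) * (w * (w + μ + ν) +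
          (k * ((μ : F) + ν) ^ 2 - B * (μ + ν) * w)) - ((w + ν) * (w - μ) +
          (k * ((μ : F) + ν) ^ 2 - B * (μ + ν) * (w - μ))) * (w * (w - μ) + k * (μ : F) ^ 2) +
        (2 * μ + ν) ^ 2 * (w * (w + ν) + (k * (ν : F) ^ 2 - B * ν * w))) := by
    intro q h1 h2 w hw
    have k1 := key q h1 h2
    have k2 := key (q + μ) (by rw [h.deviation_add, h1]) (by rw [shift, h2])
    have k3 := key (q - μ) (by rw [h.deviation_sub, h1]) (by
      rw [← shift, sub_add_cancel, h2])
    refine h.deviation_rel' μ ν q w _ _ _ _ _ _ _ hw ?_ ?_ ?_ ?_ ?_ ?_ ?_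
    · rw [k1.1, hw]
    · rw [h2]
    · rw [h1]
    · rw [k2.1, hw]; push_cast; ring
    · rw [k1.2, hw]
    · rw [k3.2, hw]; push_cast; ring
    · rw [h1]
  -- Subtracting the identity at `p + μ` from the one at `p` leaves only a multiple of `B ^ 2`.
  have b0 := base p dk dB _ rfl
  have b1 := base (p + μ) (by rw [h.deviation_add, dk]) (by rw [shift, dB]) (a + p + μ)
    (by push_cast; ring)
  have hB2 : (μ : F) ^ 4 * (μ + 2 * ν) * B ^ 2 = 0 := by
    linear_combination b0 - b1
  have hB0 : B = 0 := by
    simpa [hμ, hμν2] using hB2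
  rw [dB, dk, hB0, add_zero]

/-- The round trips are those of `A_{a,b}` with `b (1 - b) = K`. -/
theorem exists_roundTrip (h : FullEdgeRel a e) : ∃ K : F, ∀ x y : M, roundTrip e x y =
    (a + x) * (a + y) + K * ((x : F) - y) ^ 2 := by
  have transl : ∀ μ ν p : M, (μ : F) ≠ 0 → deviation a e μ (p + ν) = deviation a e μ p := by
    intro μ ν p hμ
    by_cases hν : (ν : F) = 0
    · have : ν = 0 := by simpa using hν
      simp [this]
    -- The two directions excluded from `deviation_translate` follow from constancy along a line and
    -- from doubling.
    by_cases h1 : (μ : F) + ν = 0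
    · have : ν = -μ := by
        apply Subtype.ext
        push_cast
        linear_combination h1
      rw [this, ← sub_eq_add_neg, h.deviation_sub]
    by_cases h2 : (μ : F) + 2 * ν = 0
    · have : μ = 2 • (-ν) := by
        apply Subtype.ext
        simp
        linear_combination h2
      rw [this, h.deviation_two, h.deviation_two, h.deviation_neg, h.deviation_neg,
        h.deviation_add]
    exact h.deviation_translate μ ν p hμ hν h1 h2
  by_cases hM : ∃ δ : M, (δ : F) ≠ 0
  · obtain ⟨δ, hδ⟩ := hM
    refine ⟨deviation a e δ 0 / (δ : F) ^ 2, fun x y => ?_⟩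
    rw [roundTrip_eq (a := a) x y]
    congr 1
    by_cases hxy : y - x = 0
    · rw [hxy, h.deviation_zero, sub_eq_zero.1 hxy]; simp
    · have hxy' : ((y - x : M) : F) ≠ 0 := fun h0 => hxy (Subtype.ext h0)
      have h1 := (h.deviation_slope δ (y - x) x hδ hxy').1
      rw [transl δ _ x hδ, sub_self, neg_zero, zero_mul] at h1
      have h2 := (mul_eq_zero.1 h1).resolve_left hxy'
      rw [sub_eq_zero, div_eq_iff (pow_ne_zero 2 hxy')] at h2
      have h3 := transl δ x 0 hδ
      rw [zero_add] at h3
      rw [h2, h3]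
      push_cast
      ring
  · push Not at hM
    refine ⟨0, fun x y => ?_⟩
    have : y = x := Subtype.ext (by
      have h1 := hM (y - x)
      push_cast at h1
      exact sub_eq_zero.1 h1)
    rw [this, h.roundTrip_self]; ring

end FullEdgeRel

end RoundTrips


/-! ### Circulations of triangles and the parameter `b` -/

section Triangles

variable {F : Type*} [Field F] {M : AddSubgroup F} {a : F} {e : M → M → F}

/-- The difference of the two orientations of a triangle. -/
def circulation (e : M → M → F) (x y z : M) : F := triangle e x y z - triangle e x z y

theorem circulation_rotate (x y z : M) : circulation e x y z = circulation e y z x := by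
  simp only [circulation, triangle]; ring

theorem circulation_swap (x y z : M) : circulation e x z y = -circulation e x y z := by
  simp only [circulation]; ring

theorem circulation_sq (x y z : M) : circulation e x y z ^ 2 =
    (triangle e x y z + triangle e x z y) ^ 2 -
      4 * (roundTrip e x y * roundTrip e y z * roundTrip e x z) := by
  rw [← triangle_mul_triangle, circulation]; ring

theorem circulation_left (x z : M) : circulation e x x z = 0 := by
  simp only [circulation, triangle]; ring

theorem circulation_right (x y : M) : circulation e x y y = 0 := by
  simp only [circulation, triangle]; ring

theorem circulation_outer (x y : M) : circulation e x y x = 0 := by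
  simp only [circulation, triangle]; ring

/-- The four faces of a tetrahedron. -/
theorem tetrahedron (e : M → M → F) (x y z w : M) :
    roundTrip e y w * ((triangle e x y z + triangle e x z y) * circulation e x z w +
      (triangle e x z w + triangle e x w z) * circulation e x y z) =
    roundTrip e x z * ((triangle e y z w + triangle e y w z) * circulation e y w x +
      (triangle e y w x + triangle e y x w) * circulation e y z w) := by
  simp only [roundTrip, triangle, circulation]; ring

namespace FullEdgeRel

/-- Both orientations change by the same amount under reflection, so their difference is invariant.
-/
theorem circulation_reflect (h : FullEdgeRel a e) (x y z y' : M) (hy : y + y' = x + z) :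
    circulation e x y z = circulation e x y' z := by
  have h1 := h.triangle_reflect x y z y' hy
  have h2 := h.triangle_reflect' x y z y' hy
  simp only [circulation]
  linear_combination h1 - h2

/-- Two vertex reflections carry the triangle to its translate by `μ`. -/
theorem circulation_translate (h : FullEdgeRel a e) (p μ ν : M) :
    circulation e (p + μ) (p + μ + μ) (p + μ + ν) = circulation e p (p + μ) (p + ν) := by
  rw [circulation_rotate p, circulation_rotate (p + μ) (p + ν),
    h.circulation_reflect (p + ν) p (p + μ) (p + μ + ν) (by abel),
    ← circulation_rotate (p + μ) (p + ν) (p + μ + ν),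
    h.circulation_reflect (p + μ) (p + ν) (p + μ + ν) (p + μ + μ) (by abel)]

/-- Compares halves of one parallelogram cut along its two diagonals, in agreement with
proportionality to `(y - x) * (z - y) * (x - z)`. -/
theorem circulation_parallelogram (h : FullEdgeRel a e) (x y z y' : M) (hy : y + y' = x + z) :
    ((y' : F) - y) * circulation e x y z = ((z : F) - x) * circulation e x y y' := by
  have h1 := h.rel z y' x y (by rw [add_comm, hy, add_comm])
  have h2 := h.rel x y' z y (by rw [add_comm, hy])
  have h3 := h.rel y z y' x (by rw [add_comm, hy])
  have h4 := h.rel y' z y x (by rw [add_comm, ← hy, add_comm])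
  simp only [circulation, triangle]
  linear_combination -(e x y * e y z) * h1 + (e y x * e z y) * h2 + (e x y * e y' x) * h3 -
    (e y x * e x y') * h4

/-- `parallelogram` gives the sum unless `y` is the midpoint of `x` and `z`. If two vertices are
midpoints the triangle is degenerate; otherwise a rotation avoids the exception. -/
theorem triangle_sum [CharZero F] (h : FullEdgeRel a e) {K : F}
    (hK : ∀ x y : M, roundTrip e x y = (a + x) * (a + y) + K * ((x : F) - y) ^ 2) (x y z : M) :
    triangle e x y z + triangle e x z y = 2 * (a + x) * (a + y) * (a + z) -
      K * ((2 * a + x + y) * (z - y) * (x - z) + (2 * a + y + z) * (x - z) * (y - x) +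
        (2 * a + z + x) * (y - x) * (z - y)) := by
  have key : ∀ x y z : M, (2 * y : F) ≠ x + z → triangle e x y z + triangle e x z y =
      2 * (a + x) * (a + y) * (a + z) -
      K * ((2 * a + x + y) * (z - y) * (x - z) + (2 * a + y + z) * (x - z) * (y - x) +
        (2 * a + z + x) * (y - x) * (z - y)) := by
    intro x y z hne
    have := h.parallelogram x y z (x + z - y) (by abel)
    simp only [hK] at this
    push_cast at this
    have hne' : (y : F) - (x + z - y) ≠ 0 := by
      intro h0; apply hne; linear_combination h0
    apply mul_left_cancel₀ hne'
    linear_combination -this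
  by_cases h1 : (2 * y : F) = x + z
  · by_cases h2 : (2 * z : F) = y + x
    · have e1 : y = z := Subtype.ext (by
        have : (3 : F) * y = 3 * z := by linear_combination h1 - h2
        simpa using this)
      have e2 : x = z := Subtype.ext (by
        rw [e1] at h1; linear_combination -h1)
      subst e1 e2
      simp only [triangle, h.self]
      ring
    · have := key y z x h2
      rw [← triangle_rotate x y z, triangle_rotate y x z] at this
      linear_combination this
  · exact key x y z h1

variable [CharZero F]

/-- All circulations in a plane with collinear points are proportional to those of `A_{a,b}`. -/
theorem circulation_collinear (h : FullEdgeRel a e) (p μ ν : M) (hμ : (μ : F) ≠ 0)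
    (hν : (ν : F) ≠ 0) (h1 : (ν : F) - μ ≠ 0) (h2 : (ν : F) - 2 * μ ≠ 0) :
    2 * (μ : F) ^ 2 * circulation e p (p + μ) (p + ν) =
      ν * (ν - μ) * circulation e p (p + μ) (p + μ + μ) := by
  obtain ⟨K, hK⟩ := h.exists_roundTrip
  set m : F := (μ : F) with hm
  set n : F := (ν : F) with hn
  -- Normalised circulations of three faces of the tetrahedron `p, p + μ, p + μ + μ, p + ν`. They
  -- are unchanged by translation by `μ + μ`, and the fourth face reduces to `E1` by
  -- `circulation_parallelogram`.
  set E1 : F := circulation e p (p + μ) (p + ν) / (m * (n - m) * (-n)) with hE1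
  set E2 : F := circulation e p (p + (μ + μ)) (p + ν) / (2 * m * (n - 2 * m) * (-n)) with hE2
  set E3 : F := circulation e p (p + μ) (p + μ + μ) / (m * m * (-(2 * m))) with hE3
  set q : ℕ → M := fun k => p + k • (μ + μ) with hq
  have hqs : ∀ k, q (k + 1) = q k + μ + μ := fun k => by
    simp only [hq, add_nsmul, one_nsmul]; abel
  have D1 : ∀ k, circulation e (q k) (q k + μ) (q k + ν) = E1 * (m * (n - m) * (-n)) := by
    intro k
    induction k with
    | zero =>
      simp only [hq, zero_smul, add_zero, hE1]
      field_simp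
    | succ k ih => rw [hqs, h.circulation_translate, h.circulation_translate, ih]
  have D2 : ∀ k, circulation e (q k) (q k + μ + μ) (q k + ν) =
      E2 * (2 * m * (n - 2 * m) * (-n)) := by
    intro k
    induction k with
    | zero =>
      simp only [hq, zero_smul, add_zero, hE2, add_assoc]
      field_simp
    | succ k ih =>
      have := h.circulation_translate (q k) (μ + μ) ν
      simp only [← add_assoc] at this
      rw [hqs, this, ih]
  have D3 : ∀ k, circulation e (q k) (q k + μ) (q k + μ + μ) = E3 * (m * m * (-(2 * m))) := by
    intro k
    induction k with
    | zero =>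
      simp only [hq, zero_smul, add_zero, hE3]
      field_simp
    | succ k ih =>
      have := h.circulation_translate (q k) μ (μ + μ)
      simp only [← add_assoc] at this
      have h' := h.circulation_translate (q k + μ) μ (μ + μ)
      simp only [← add_assoc] at h'
      rw [hqs, h', this, ih]
  have D4 : ∀ k, circulation e (q k + μ) (q k + μ + μ) (q k + ν) =
      E1 * (m * (n - 2 * m) * (-(n - m))) := by
    intro k
    have r1 := h.circulation_reflect (q k + μ) (q k + μ + μ) (q k + ν) (q k + ν - μ) (by abel)
    have r2 := h.circulation_parallelogram (q k + μ) (q k + ν) (q k + ν - μ) (q k) (by abel)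
    have r3 := h.circulation_parallelogram (q k + ν) (q k) (q k + μ) (q k + μ + ν) (by abel)
    rw [r1, circulation_swap]
    have r4 := D1 k
    rw [circulation_rotate] at r4
    rw [r4] at r2
    push_cast at r2
    apply mul_left_cancel₀ hν
    rw [← hm, ← hn] at r2
    linear_combination r2
  -- The tetrahedron identity becomes a polynomial of degree 5 in the weight `w`, linear in the
  -- discrepancies `X` and `Y`; its two leading coefficients already give `Y = 0`.
  set X : F := (E2 - E1) * (2 * m * (n - 2 * m) * (-n)) with hX
  set Y : F := (E3 - E1) * (m * m * (-(2 * m))) with hY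
  set b1 : F := m + n with hb1
  set c1 : F := m * n + K * (n - m) ^ 2 with hc1
  -- the sums of the two orientations of the faces `(B, C, p)` and `(B, p, A)`
  set f1 : F := 2 * (2 * m * n) - K * (2 * ((-n) * (2 * m) + (2 * m) * (n - 2 * m) +
    (n - 2 * m) * (-n))) with hf1
  set f0 : F := -(K * ((2 * m + n) * (-n) * (2 * m) + n * (2 * m) * (n - 2 * m) +
    (2 * m) * (n - 2 * m) * (-n))) with hf0
  set g1 : F := 2 * (2 * m * m) - K * (2 * (m * m + m * (-(2 * m)) + (-(2 * m)) * m)) with hg1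
  set g0 : F := -(K * ((2 * m) * m * m + m * m * (-(2 * m)) + (3 * m) * (-(2 * m)) * m)) with hg0
  have main : ∀ k : ℕ, ∀ w : F, w = (a + p) + k * (2 * m) →
      (w ^ 2 + b1 * w + c1) * ((2 * w ^ 3 + 2 * (2 * m + n) * w ^ 2 + f1 * w + f0) * Y +
        (2 * w ^ 3 + 2 * (3 * m) * w ^ 2 + g1 * w + g0) * X) = 0 := by
    intro k w hw
    have hqw : a + (q k : F) = w := by
      rw [hw]; simp [hq]; ring
    have hqa : (q k : F) = w - a := by rw [← hqw]; ring
    have tet := tetrahedron e (q k + μ) (q k + μ + μ) (q k + ν) (q k)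
    have c1' : circulation e (q k + μ) (q k + ν) (q k) = E1 * (m * (n - m) * (-n)) := by
      rw [← circulation_rotate, D1]
    have c2' : circulation e (q k + μ + μ) (q k) (q k + μ) = E3 * (m * m * (-(2 * m))) := by
      rw [circulation_rotate, D3]
    have c3' : circulation e (q k + μ + μ) (q k + ν) (q k) =
        E2 * (2 * m * (n - 2 * m) * (-n)) := by
      rw [← circulation_rotate, D2]
    rw [c1', D4, c2', c3'] at tet
    simp only [h.triangle_sum hK, hK] at tet
    push_cast at tet
    rw [hqa, ← hm, ← hn] at tet
    simp only [hX, hY, hb1, hc1, hf1, hf0, hg1, hg0]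
    linear_combination -tet
  have co := coeffs_eq_zero_of_progression (c1 * (f0 * Y + g0 * X))
    (b1 * (f0 * Y + g0 * X) + c1 * (f1 * Y + g1 * X))
    (f0 * Y + g0 * X + b1 * (f1 * Y + g1 * X) + c1 * (2 * (2 * m + n) * Y + 2 * (3 * m) * X))
    (f1 * Y + g1 * X + b1 * (2 * (2 * m + n) * Y + 2 * (3 * m) * X) + c1 * (2 * Y + 2 * X))
    (2 * (2 * m + n) * Y + 2 * (3 * m) * X + b1 * (2 * Y + 2 * X)) (2 * Y + 2 * X)
    (a + p) (2 * m) (by simpa using hμ) (fun k => by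
      have := main k _ rfl
      linear_combination this)
  obtain ⟨-, -, -, -, h4, h5⟩ := co
  have hY0 : (n - m) * Y = 0 := by
    linear_combination (1 / 2 : F) * h4 - (1 / 2 : F) * (b1 + 3 * m) * h5
  have hY1 := (mul_eq_zero.1 hY0).resolve_left h1
  have hE : E3 = E1 := by
    have h0 : m * m * (-(2 * m)) ≠ 0 := by simpa using hμ
    rw [hY] at hY1
    exact sub_eq_zero.1 ((mul_eq_zero.1 hY1).resolve_right h0)
  have r1 := D1 0
  have r3 := D3 0
  simp only [hq, zero_smul, add_zero] at r1 r3
  rw [r1, r3, hE]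
  ring

/-- `circulation_sq` fixes each circulation only up to sign; the content is that one constant serves
all triangles. -/
theorem exists_circulation (h : FullEdgeRel a e) : ∃ E : F, ∀ x y z : M,
    circulation e x y z = E * (((y : F) - x) * (z - y) * (x - z)) := by
  by_cases hM : ∃ δ : M, (δ : F) ≠ 0
  swap
  · push Not at hM
    refine ⟨0, fun x y z => ?_⟩
    have : y = x := Subtype.ext (by
      have h1 := hM (y - x)
      push_cast at h1
      exact sub_eq_zero.1 h1)
    rw [this, circulation_left, zero_mul]
  obtain ⟨δ, hδ⟩ := hM
  set E0 : M → M → F := fun p μ => circulation e p (p + μ) (p + μ + μ) / (-(2 * (μ : F) ^ 3))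
    with hE0
  have hE0' : ∀ p μ : M, (μ : F) ≠ 0 →
      circulation e p (p + μ) (p + μ + μ) = E0 p μ * (-(2 * (μ : F) ^ 3)) := by
    intro p μ hμ
    simp only [hE0]
    field_simp
  have gen : ∀ p μ ν : M, (μ : F) ≠ 0 → (ν : F) ≠ 0 → (ν : F) - μ ≠ 0 → (ν : F) - 2 * μ ≠ 0 →
      circulation e p (p + μ) (p + ν) = E0 p μ * (μ * (ν - μ) * (-ν)) := by
    intro p μ ν hμ hν h1 h2
    have := h.circulation_collinear p μ ν hμ hν h1 h2
    rw [hE0' p μ hμ] at this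
    have h0 : 2 * (μ : F) ^ 2 ≠ 0 := by simpa using hμ
    apply mul_left_cancel₀ h0
    linear_combination this
  have eq1 : ∀ p μ ν : M, (μ : F) ≠ 0 → (ν : F) ≠ 0 → (ν : F) - μ ≠ 0 → (ν : F) - 2 * μ ≠ 0 →
      (μ : F) - 2 * ν ≠ 0 → E0 p μ = E0 p ν := by
    intro p μ ν hμ hν h1 h2 h3
    have h1' : (μ : F) - ν ≠ 0 := by
      intro h0; apply h1; linear_combination -h0
    have k1 := gen p μ ν hμ hν h1 h2
    have k2 := gen p ν μ hν hμ h1' h3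
    rw [circulation_swap, k1] at k2
    have h0 : (μ : F) * (ν - μ) * (-ν) ≠ 0 := mul_ne_zero (mul_ne_zero hμ h1) (neg_ne_zero.2 hν)
    apply mul_right_cancel₀ h0
    linear_combination -k2
  -- `eq1` does not compare `μ` with `2 • μ`, but it compares both with `5 • μ`.
  have eq2 : ∀ p μ : M, (μ : F) ≠ 0 → E0 p μ = E0 p (2 • μ) := by
    intro p μ hμ
    have h5 : ((5 • μ : M) : F) = 5 * μ := by simp
    have h2 : ((2 • μ : M) : F) = 2 * μ := by simp
    have aux : ∀ t : F, t ≠ 0 → t * (μ : F) ≠ 0 := fun t ht => mul_ne_zero ht hμ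
    rw [eq1 p μ (5 • μ) hμ, ← eq1 p (2 • μ) (5 • μ)]
    all_goals simp only [h5, h2]
    · exact aux 2 (by norm_num)
    · exact aux 5 (by norm_num)
    · rw [← sub_mul]; exact aux _ (by norm_num)
    · rw [← mul_assoc, ← sub_mul]; exact aux _ (by norm_num)
    · rw [← mul_assoc, ← sub_mul]; exact aux _ (by norm_num)
    · exact aux 5 (by norm_num)
    · have := aux 4 (by norm_num)
      intro h0; apply this; linear_combination h0
    · rw [← sub_mul]; exact aux _ (by norm_num)
    · have := aux 9 (by norm_num)
      intro h0; apply this; linear_combination -h0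
  have eq3 : ∀ p μ ν : M, (μ : F) ≠ 0 → (ν : F) ≠ 0 → E0 p μ = E0 p ν := by
    intro p μ ν hμ hν
    by_cases h1 : (ν : F) - μ = 0
    · rw [Subtype.ext (sub_eq_zero.1 h1)]
    by_cases h2 : (ν : F) - 2 * μ = 0
    · have : ν = 2 • μ := Subtype.ext (by simp; linear_combination h2)
      rw [this, ← eq2 p μ hμ]
    by_cases h3 : (μ : F) - 2 * ν = 0
    · have : μ = 2 • ν := Subtype.ext (by simp; linear_combination h3)
      rw [this, ← eq2 p ν hν]
    exact eq1 p μ ν hμ hν h1 h2 h3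
  -- Change the direction to `p`, translate from `0` to `p` along it, and change back.
  have eq4 : ∀ p : M, E0 p δ = E0 0 δ := by
    intro p
    by_cases hp : (p : F) = 0
    · have : p = 0 := Subtype.ext hp
      rw [this]
    · rw [eq3 p δ p hδ hp, eq3 0 δ p hδ hp]
      have := h.circulation_translate 0 p (p + p)
      simp only [← add_assoc] at this
      simp only [zero_add] at this
      simp only [hE0, zero_add, this]
  refine ⟨E0 0 δ, fun x y z => ?_⟩
  by_cases h1 : (y : F) - x = 0
  · rw [Subtype.ext (sub_eq_zero.1 h1), circulation_left]; ring
  by_cases h2 : (z : F) - y = 0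
  · rw [Subtype.ext (sub_eq_zero.1 h2), circulation_right]; ring
  by_cases h3 : (x : F) - z = 0
  · rw [Subtype.ext (sub_eq_zero.1 h3), circulation_outer]; ring
  have hμ : ((y - x : M) : F) ≠ 0 := by push_cast; exact h1
  have hν : ((z - x : M) : F) ≠ 0 := by
    push_cast; intro h0; apply h3; linear_combination -h0
  rw [← eq4 x, eq3 x δ (y - x) hδ hμ]
  by_cases h4 : ((z - x : M) : F) - 2 * ((y - x : M) : F) = 0
  · have hz : x + (y - x) + (y - x) = z := Subtype.ext (by
      push_cast at h4 ⊢; linear_combination -h4)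
    have := hE0' x (y - x) hμ
    rw [hz, show x + (y - x) = y by abel] at this
    rw [this]
    push_cast at h4 ⊢
    have hz' : (z : F) = 2 * y - x := by linear_combination h4
    rw [hz']
    ring
  · have := gen x (y - x) (z - x) hμ hν (by
      push_cast; intro h0; apply h2; linear_combination h0) h4
    rw [show x + (y - x) = y by abel, show x + (z - x) = z by abel] at this
    rw [this]
    push_cast
    ring

/-- All triangles agree with those of a module `A_{a,b}`. -/
theorem exists_triangle (h : FullEdgeRel a e) (hM : M ≠ ⊥) : ∃ b K : F, K = b * (1 - b) ∧
    (∀ x y : M, roundTrip e x y = (a + x) * (a + y) + K * ((x : F) - y) ^ 2) ∧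
    ∀ x y z : M, triangle e x y z =
      (a + x + (y - x) * b) * (a + y + (z - y) * b) * (a + z + (x - z) * b) := by
  obtain ⟨K, hK⟩ := h.exists_roundTrip
  obtain ⟨E, hE⟩ := h.exists_circulation
  obtain ⟨δ, hδ⟩ : ∃ δ : M, (δ : F) ≠ 0 := by
    obtain ⟨δ, hδ⟩ := (AddSubgroup.ne_bot_iff_exists_ne_zero).1 hM
    exact ⟨δ, fun h0 => hδ (Subtype.ext h0)⟩
  have hE2 : E ^ 2 = K ^ 2 * (1 - 4 * K) := by
    have := circulation_sq (e := e) 0 δ (δ + δ)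
    rw [hE, h.triangle_sum hK] at this
    simp only [hK] at this
    push_cast at this
    have h0 : 4 * (δ : F) ^ 6 ≠ 0 := by simpa using hδ
    apply mul_left_cancel₀ h0
    linear_combination this
  -- For `K ≠ 0`, `1 - 4 * K` is the square of `E / K`, so the quadratic equation for `b` is
  -- solvable in `F` itself; `E` selects between `b` and `1 - b`.
  obtain ⟨b, hb, hbE⟩ : ∃ b : F, K = b * (1 - b) ∧ E = (1 - 2 * b) * K := by
    by_cases hK0 : K = 0
    · refine ⟨0, by simp [hK0], ?_⟩
      rw [hK0] at hE2 ⊢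
      simpa using hE2
    · refine ⟨(1 - E / K) / 2, ?_, ?_⟩
      · have h0 : (4 : F) * K ^ 2 ≠ 0 := by simpa using hK0
        apply mul_left_cancel₀ h0
        field_simp
        linear_combination hE2
      · field_simp
        ring
  refine ⟨b, K, hb, hK, fun x y z => ?_⟩
  have h1 := h.triangle_sum hK x y z
  have h2 := hE x y z
  rw [circulation] at h2
  apply mul_left_cancel₀ (two_ne_zero (α := F))
  rw [hbE] at h2
  rw [hb] at h1 h2
  linear_combination h1 + h2

end FullEdgeRel

end Triangles


/-! ### Recovering the coefficients from the invariants -/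

section Gauge

variable {F : Type*} [Field F] {M : AddSubgroup F}

/-- Coefficient systems with the same triangles and sufficiently many nonzero round trips differ
by a rescaling of the basis. -/
theorem exists_rescaling (e k : M → M → F) (Y : Set M) (hY : Y.Infinite)
    (hbad : ∀ x ∈ Y, {y ∈ Y | roundTrip k x y = 0}.Finite)
    (hP : ∀ x ∈ Y, ∀ y ∈ Y, roundTrip e x y = roundTrip k x y)
    (hT : ∀ x ∈ Y, ∀ y ∈ Y, ∀ z ∈ Y, triangle e x y z = triangle k x y z) :
    ∃ g : M → F, (∀ x ∈ Y, g x ≠ 0) ∧ ∀ x ∈ Y, ∀ y ∈ Y, g x * e x y = g y * k x y := by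
  -- Finitely many points are bad for each vertex, so any four vertices are joined to a common `z`
  -- by nonzero round trips. The ratios `e / k` multiply along nondegenerate triangles, and `g x` is
  -- their product along a path from `o` to `x` through such a point, whichever it is.
  have good : ∀ u ∈ Y, ∀ v ∈ Y, ∀ x ∈ Y, ∀ y ∈ Y, ∃ z ∈ Y, roundTrip k u z ≠ 0 ∧
      roundTrip k v z ≠ 0 ∧ roundTrip k x z ≠ 0 ∧ roundTrip k y z ≠ 0 := by
    intro u hu v hv x hx y hy
    obtain ⟨z, hz, hz'⟩ := (hY.sdiff ((((hbad u hu).union (hbad v hv)).union (hbad x hx)).union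
      (hbad y hy))).nonempty
    simp only [Set.mem_union, Set.mem_ofPred_eq, not_or, not_and] at hz'
    exact ⟨z, hz, hz'.1.1.1 hz, hz'.1.1.2 hz, hz'.1.2 hz, hz'.2 hz⟩
  obtain ⟨o, ho⟩ := hY.nonempty
  set r : M → M → F := fun x y => e x y / k x y with hr
  have hk : ∀ x y, roundTrip k x y ≠ 0 → k x y ≠ 0 ∧ k y x ≠ 0 := fun x y h =>
    ⟨left_ne_zero_of_mul h, right_ne_zero_of_mul h⟩
  have he : ∀ x ∈ Y, ∀ y ∈ Y, roundTrip k x y ≠ 0 → e x y ≠ 0 ∧ e y x ≠ 0 := by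
    intro x hx y hy h
    rw [← hP x hx y hy] at h
    exact ⟨left_ne_zero_of_mul h, right_ne_zero_of_mul h⟩
  have edge : ∀ x ∈ Y, ∀ y ∈ Y, ∀ z ∈ Y, roundTrip k x z ≠ 0 → roundTrip k y z ≠ 0 →
      r z x * e x y = r z y * k x y := by
    intro x hx y hy z hz hxz hyz
    have t := hT z hz x hx y hy
    have p := hP y hy z hz
    have k1 := hk x z hxz
    have k2 := hk y z hyz
    have e2 := he y hy z hz hyz
    simp only [triangle, roundTrip] at t p
    simp only [hr]
    rw [div_mul_eq_mul_div, div_mul_eq_mul_div, div_eq_div_iff k1.2 k2.2]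
    apply mul_left_cancel₀ e2.1
    linear_combination k z y * t - k z x * k x y * p
  have tri : ∀ x ∈ Y, ∀ y ∈ Y, ∀ z ∈ Y, roundTrip k x z ≠ 0 → roundTrip k y z ≠ 0 →
      roundTrip k x y ≠ 0 → r z x * r x y = r z y := by
    intro x hx y hy z hz hxz hyz hxy
    have := edge x hx y hy z hz hxz hyz
    rw [show r x y = e x y / k x y from rfl, ← mul_div_assoc, div_eq_iff (hk x y hxy).1, this]
  have hex : ∀ x, ∃ y, x ∈ Y → y ∈ Y ∧ roundTrip k o y ≠ 0 ∧ roundTrip k x y ≠ 0 := by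
    intro x
    by_cases hx : x ∈ Y
    · obtain ⟨y, hy, h1, -, h2, -⟩ := good o ho o ho x hx x hx
      exact ⟨y, fun _ => ⟨hy, h1, h2⟩⟩
    · exact ⟨o, fun h => absurd h hx⟩
  choose mid hmid using hex
  set g : M → F := fun x => r o (mid x) * r (mid x) x with hg
  have indep : ∀ x ∈ Y, ∀ y ∈ Y, roundTrip k o y ≠ 0 → roundTrip k x y ≠ 0 →
      g x = r o y * r y x := by
    intro x hx y hy h1 h2
    obtain ⟨hm, m1, m2⟩ := hmid x hx
    have aux : ∀ y ∈ Y, roundTrip k o y ≠ 0 → roundTrip k x y ≠ 0 → ∀ z ∈ Y,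
        roundTrip k o z ≠ 0 → roundTrip k x z ≠ 0 → roundTrip k y z ≠ 0 →
        r o y * r y x = r o z * r z x := by
      intro y hy h1 h2 z hz z1 z2 z3
      have t1 := tri y hy z hz o ho (by rwa [roundTrip_comm]) (by rwa [roundTrip_comm]) z3
      have t2 := tri z hz x hx y hy (by rwa [roundTrip_comm]) h2 (by rwa [roundTrip_comm])
      rw [← t1, ← t2]; ring
    obtain ⟨z, hz, z1, z2, z3, z4⟩ := good o ho x hx y hy (mid x) hm
    rw [aux y hy h1 h2 z hz z1 z2 z3, hg]
    exact aux (mid x) hm m1 m2 z hz z1 z2 z4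
  refine ⟨g, fun x hx => ?_, fun x hx y hy => ?_⟩
  · obtain ⟨hm, m1, m2⟩ := hmid x hx
    exact mul_ne_zero (div_ne_zero (he o ho _ hm m1).1 (hk _ _ m1).1)
      (div_ne_zero (he x hx _ hm m2).2 (hk _ _ m2).2)
  · obtain ⟨z, hz, z1, z2, z3, -⟩ := good o ho x hx y hy y hy
    rw [indep x hx z hz z1 z2, indep y hy z hz z1 z3, mul_assoc, mul_assoc,
      edge x hx y hy z hz z2 z3]

variable [CharZero F]

/-- The functional equation for the arrows into or out of the weight `0`. -/
theorem affine_of_functional_equation (h : M → F)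
    (hh : ∀ y y' : M, y ≠ 0 → y' ≠ 0 → y + y' ≠ 0 →
      (y : F) * h y - y' * h y' = ((y : F) - y') * h (y + y')) :
    ∃ α β : F, ∀ y : M, y ≠ 0 → h y = α + β * y := by
  by_cases hM : ∃ μ : M, μ ≠ 0
  swap
  · push Not at hM
    exact ⟨0, 0, fun y hy => absurd (hM y) hy⟩
  obtain ⟨μ, hμ⟩ := hM
  have ne : ∀ x : M, x ≠ 0 → (x : F) ≠ 0 := fun x hx h0 => hx (Subtype.ext h0)
  have hm := ne μ hμ
  -- The affine function agreeing with `h` at `μ` and `μ + μ`.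
  set β : F := (h (μ + μ) - h μ) / μ with hβ
  set α : F := h μ - β * μ with hα
  refine ⟨α, β, fun y hy => ?_⟩
  set f : M → F := fun y => h y - (α + β * y) with hf
  suffices hfy : f y = 0 from sub_eq_zero.1 hfy
  have hff : ∀ y y' : M, y ≠ 0 → y' ≠ 0 → y + y' ≠ 0 →
      (y : F) * f y - y' * f y' = ((y : F) - y') * f (y + y') := by
    intro y y' h1 h2 h3
    simp only [hf]
    push_cast
    linear_combination hh y y' h1 h2 h3
  have f1 : f μ = 0 := by simp only [hf, hα]; ring
  have f2 : f (μ + μ) = 0 := by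
    simp only [hf, hα, hβ]
    push_cast
    field_simp
    ring
  have hμμ : μ + μ ≠ 0 := by
    intro h0
    have := congrArg (fun t : M => (t : F)) h0
    push_cast at this
    have h2 : (2 : F) * μ = 0 := by linear_combination this
    simp [hm] at h2
  have f3 : f (-μ) = 0 := by
    have := hff (μ + μ) (-μ) hμμ (neg_ne_zero.2 hμ) (by simpa using hμ)
    rw [show μ + μ + -μ = μ by abel, f1, f2] at this
    push_cast at this
    have h2 : (μ : F) * f (-μ) = 0 := by linear_combination this
    exact (mul_eq_zero.1 h2).resolve_left hm
  by_cases c1 : y + μ = 0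
  · rw [eq_neg_of_add_eq_zero_left c1, f3]
  by_cases c2 : y + (μ + μ) = 0
  · have := hff y μ hy hμ c1
    rw [eq_neg_of_add_eq_zero_left c2, show -(μ + μ) + μ = -μ by abel, f1, f3] at this
    rw [eq_neg_of_add_eq_zero_left c2]
    push_cast at this
    have h2 : ((2 : F) * μ) * f (-(μ + μ)) = 0 := by linear_combination -this
    exact (mul_eq_zero.1 h2).resolve_left (mul_ne_zero two_ne_zero hm)
  -- `f (y + μ + μ)` is reached by one step `μ + μ` or two steps `μ`; elimination leaves a nonzero
  -- multiple of `f y`.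
  have r1 := hff y μ hy hμ c1
  have r2 := hff y (μ + μ) hy hμμ c2
  have r3 := hff (y + μ) μ c1 hμ (by rwa [add_assoc])
  rw [add_assoc] at r3
  rw [f1] at r1 r3
  rw [f2] at r2
  push_cast at r1 r2 r3
  have h0 : 2 * (μ : F) ^ 2 * y ≠ 0 := by
    simpa [hm] using ne y hy
  apply (mul_eq_zero.1 ?_).resolve_left h0
  linear_combination y * (y - μ) * r2 - ((y : F) - 2 * μ) * (y + μ) * r1 -
    (y - μ) * (y - 2 * μ) * r3

/-- The coefficient systems of the modules `A_{a,b}`, `A_a` and `B_a`. -/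
def IsStandardCoeff (k : M → M → F) : Prop :=
  (∃ a b, k = coeffAab a b) ∨ (∃ a, k = coeffA a) ∨ ∃ a, k = coeffB a

theorem infinite_of_ne_bot (hM : M ≠ ⊥) : Infinite M := by
  obtain ⟨δ, hδ⟩ := (AddSubgroup.ne_bot_iff_exists_ne_zero).1 hM
  have hd : (δ : F) ≠ 0 := fun h0 => hδ (Subtype.ext h0)
  refine Infinite.of_injective (fun n : ℕ => n • δ) fun m n hmn => ?_
  have := congrArg (fun t : M => (t : F)) hmn
  simpa [hd] using this

/-- The arrows at the weight `0` after normalisation of all other arrows. -/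
theorem FullEdgeRel.zero_weight {e : M → M → F} (h : FullEdgeRel 0 e) (hM : M ≠ ⊥)
    (hP : ∀ x : M, roundTrip e 0 x = 0) (hiso : ¬ ∀ x : M, x ≠ 0 → e 0 x = 0 ∧ e x 0 = 0)
    (g : M → F) (hg : ∀ x, x ≠ 0 → g x ≠ 0)
    (hge : ∀ x y, x ≠ 0 → y ≠ 0 → g x * e x y = g y * y) :
    ∃ k : M → M → F, IsStandardCoeff k ∧ ∃ g : M → F, (∀ x, g x ≠ 0) ∧
      ∀ x y, g x * e x y = g y * k (y - x) x := by
  classical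
  have := infinite_of_ne_bot hM
  have ne : ∀ x : M, x ≠ 0 → (x : F) ≠ 0 := fun x hx h0 => hx (Subtype.ext h0)
  have he : ∀ x y, x ≠ 0 → y ≠ 0 → e x y = g y * y / g x := fun x y hx hy => by
    rw [eq_div_iff (hg x hx), mul_comm, hge x y hx hy]
  have e00 : e 0 0 = 0 := by simpa using h.self 0
  obtain ⟨α, β, hX⟩ := affine_of_functional_equation (fun y : M => e 0 y / g y / y) (by
    intro y y' hy hy' hz
    have := h.rel 0 y (y + y') y' (by abel)
    rw [he _ _ hy hz, he _ _ hy' hz] at this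
    have n1 := ne _ hy
    have n2 := ne _ hy'
    have n3 := ne _ hz
    have g1 := hg _ hy
    have g2 := hg _ hy'
    have g3 := hg _ hz
    field_simp at this ⊢
    linear_combination this)
  obtain ⟨α', β', hY⟩ := affine_of_functional_equation (fun y : M => g y * e y 0) (by
    intro y y' hy hy' hz
    have := h.rel (y + y') y 0 y' (by abel)
    rw [he _ _ hz hy, he _ _ hz hy'] at this
    have g3 := hg _ hz
    field_simp at this
    linear_combination this)
  have hX' : ∀ y : M, y ≠ 0 → e 0 y = g y * (y * (α + β * y)) := by
    intro y hy
    rw [← hX y hy]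
    have n1 := ne _ hy
    have g1 := hg _ hy
    field_simp
  have hY' : ∀ y : M, y ≠ 0 → e y 0 = (α' + β' * y) / g y := by
    intro y hy
    rw [← hY y hy]
    have g1 := hg _ hy
    field_simp
  have hXY : ∀ y : M, y ≠ 0 → (α + β * y) * (α' + β' * y) = 0 := by
    intro y hy
    have := hP y
    rw [roundTrip, hX' y hy, hY' y hy] at this
    have n1 := ne _ hy
    have g1 := hg _ hy
    field_simp at this
    apply mul_left_cancel₀ n1
    linear_combination this
  -- A product of two affine functions vanishing along a progression has a zero factor: all arrows
  -- out of `0` vanish, or all arrows into it.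
  have hdich : (α = 0 ∧ β = 0) ∨ (α' = 0 ∧ β' = 0) := by
    obtain ⟨δ, hδ⟩ := exists_ne (0 : M)
    have hd := ne δ hδ
    have hcoef := coeffs_eq_zero_of_progression (α * α') (α * β' + β * α') (β * β') 0 0 0 δ δ hd
      (fun n => by
        have := hXY ((n + 1) • δ) (smul_ne_zero (by omega) hδ)
        simp only [AddSubgroup.coe_nsmul, nsmul_eq_mul] at this
        push_cast at this
        linear_combination this)
    obtain ⟨h0, h1, h2, -⟩ := hcoef
    by_cases hα : α = 0
    · by_cases hβ : β = 0
      · exact Or.inl ⟨hα, hβ⟩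
      · rw [hα] at h1
        simp [hβ] at h1 h2
        exact Or.inr ⟨h1, h2⟩
    · simp [hα] at h0
      rw [h0] at h1
      simp [hα] at h1
      exact Or.inr ⟨h0, h1⟩
  rcases hdich with ⟨rfl, rfl⟩ | ⟨rfl, rfl⟩
  · have e0 : ∀ y, e 0 y = 0 := fun y => by
      by_cases hy : y = 0
      · rw [hy, e00]
      · rw [hX' y hy]; ring
    by_cases hβ : β' = 0
    · have hα : α' ≠ 0 := by
        rintro rfl
        exact hiso fun x hx => ⟨e0 x, by rw [hY' x hx, hβ]; simp⟩
      -- Multiplying `g` by `x` replaces the target weight `y` by the source weight `x` as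
      -- coefficient, the form found in `A_{0,0}` and `B_a`; the value at `0` matches the arrows
      -- into `0`.
      refine ⟨coeffAab 0 0, Or.inl ⟨0, 0, rfl⟩, fun x => if x = 0 then α' else g x * x, ?_, ?_⟩
      · intro x
        by_cases hx : x = 0
        · simpa [hx] using hα
        · simpa [hx] using hg x hx
      · intro x y
        by_cases hx : x = 0
        · simp [hx, e0, coeffAab]
        · by_cases hy : y = 0
          · have g1 := hg _ hx
            simp [hx, hy, coeffAab, hY' x hx, hβ]
            field_simp
          · simp only [hx, hy, if_false, coeffAab]
            linear_combination (x : F) * hge x y hx hy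
    · refine ⟨coeffB (-α' / β'), Or.inr (Or.inr ⟨_, rfl⟩),
        fun x => if x = 0 then -β' else g x * x, ?_, ?_⟩
      · intro x
        by_cases hx : x = 0
        · simpa [hx] using hβ
        · simpa [hx] using hg x hx
      · intro x y
        by_cases hx : x = 0
        · subst hx
          rw [e0]
          by_cases hy : y = 0
          · simp [hy, coeffB]
          · have : ¬ (0 : M) = -(y - 0) := by simpa [eq_comm] using hy
            simp only [coeffB, if_neg this]
            simp
        · by_cases hy : y = 0
          · have g1 := hg _ hx
            simp [hx, hy, coeffB, hY' x hx]
            field_simp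
            ring
          · have : ¬ x = -(y - x) := fun h0 => hy (sub_eq_self.1 (by rwa [neg_sub, eq_comm] at h0))
            simp only [hx, hy, if_false, coeffB, if_neg this]
            linear_combination (x : F) * hge x y hx hy
  · have e0 : ∀ y, e y 0 = 0 := fun y => by
      by_cases hy : y = 0
      · rw [hy, e00]
      · rw [hY' y hy]; simp
    by_cases hβ : β = 0
    · have hα : α ≠ 0 := by
        rintro rfl
        exact hiso fun x hx => ⟨by rw [hX' x hx, hβ]; simp, e0 x⟩
      refine ⟨coeffAab 0 1, Or.inl ⟨0, 1, rfl⟩, fun x => if x = 0 then α⁻¹ else g x, ?_, ?_⟩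
      · intro x
        by_cases hx : x = 0
        · simpa [hx] using hα
        · simpa [hx] using hg x hx
      · intro x y
        by_cases hy : y = 0
        · simp [hy, e0, coeffAab]
        · by_cases hx : x = 0
          · simp [hx, hy, coeffAab, hX' y hy, hβ]
            field_simp
          · simp only [hx, hy, if_false, coeffAab]
            push_cast
            linear_combination hge x y hx hy
    · refine ⟨coeffA (α / β), Or.inr (Or.inl ⟨_, rfl⟩),
        fun x => if x = 0 then β⁻¹ else g x, ?_, ?_⟩
      · intro x
        by_cases hx : x = 0
        · simpa [hx] using hβ
        · simpa [hx] using hg x hx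
      · intro x y
        by_cases hy : y = 0
        · rw [hy, e0]
          by_cases hx : x = 0
          · simp [hx, coeffA]
          · simp [hx, coeffA]
        · by_cases hx : x = 0
          · simp [hx, hy, coeffA, hX' y hy]
            field_simp
            ring
          · simp only [hx, hy, if_false, coeffA]
            push_cast
            linear_combination hge x y hx hy

/-- Up to rescaling, the matrix coefficients are standard. -/
theorem FullEdgeRel.exists_standard {a : F} {e : M → M → F} {S : Set M} (h : FullEdgeRel a e)
    (hM : M ≠ ⊥) (ha : a = 0 ∨ ∀ x : M, a + x ≠ 0) (hS : ∀ x : M, a + (x : F) ≠ 0 → x ∈ S)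
    (hSe : ∀ x y, x ∉ S → e x y = 0)
    (hiso : 0 ∈ S → a = 0 → ¬ ∀ x : M, x ≠ 0 → e 0 x = 0 ∧ e x 0 = 0) :
    ∃ k : M → M → F, IsStandardCoeff k ∧ ∃ g : M → F, (∀ x ∈ S, g x ≠ 0) ∧
      (∀ x ∈ S, ∀ y ∈ S, g x * e x y = g y * k (y - x) x) ∧
      ∀ x ∈ S, ∀ y, y ∉ S → k (y - x) x = 0 := by
  have := infinite_of_ne_bot hM
  have hinj : Function.Injective (fun x : M => (x : F)) := Subtype.coe_injective
  obtain ⟨b, K, hb, hP, hT⟩ := h.exists_triangle hM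
  -- For `K = 0`, `b` is `0` or `1`, and both give the triangles `(a + x) * (a + y) * (a + z)`. On
  -- the nonzero weights no round trip vanishes, and the coefficients are rescaled to `a + y`.
  by_cases hK : K = 0
  · set Y : Set M := {x | a + (x : F) ≠ 0} with hY
    have hYinf : Y.Infinite := by
      have hfin : Yᶜ.Finite := by
        refine Set.Subsingleton.finite fun x hx y hy => hinj ?_
        simp only [hY, Set.mem_compl_iff, Set.mem_ofPred_eq, not_not] at hx hy
        simpa using hx.trans hy.symm
      simpa using hfin.infinite_compl
    obtain ⟨g, hg, hge⟩ := exists_rescaling e (fun _ y => a + y) Y hYinf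
      (by
        intro x hx
        convert Set.finite_empty
        ext y
        simp only [Set.mem_ofPred_eq, Set.mem_empty_iff_false, iff_false, not_and, roundTrip]
        intro hy
        exact mul_ne_zero hy hx)
      (by
        intro x _ y _
        rw [hP, hK, roundTrip]; ring)
      (by
        intro x _ y _ z _
        rw [hT, triangle]
        have hb' : b * (1 - b) = 0 := by rw [← hb, hK]
        rcases mul_eq_zero.1 hb' with hb0 | hb0
        · rw [hb0]; ring
        · rw [show b = 1 by linear_combination -hb0]; ring)
    by_cases hz : a = 0 ∧ (0 : M) ∈ S
    · obtain ⟨rfl, h0⟩ := hz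
      have hY' : ∀ x : M, x ≠ 0 → x ∈ Y := fun x hx => by
        simpa [hY] using hx
      obtain ⟨k, hk, g', hg', hge'⟩ := h.zero_weight hM (fun x => by
        rw [hP, hK]; simp) (hiso h0 rfl) g (fun x hx => hg x (hY' x hx)) (fun x y hx hy => by
        have := hge x (hY' x hx) y (hY' y hy)
        simpa using this)
      have hSu : ∀ x, x ∈ S := fun x => by
        by_cases hx : x = 0
        · rwa [hx]
        · exact hS x (hY' x hx)
      exact ⟨k, hk, g', fun x _ => hg' x, fun x _ y _ => hge' x y,
        fun x _ y hy => absurd (hSu y) hy⟩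
    · have hSY : ∀ x, x ∈ S → x ∈ Y := by
        intro x hx h0
        rcases ha with ha | ha
        · apply hz
          have hx0 : x = 0 := by
            rw [ha, zero_add] at h0
            exact hinj h0
          exact ⟨ha, hx0 ▸ hx⟩
        · exact ha x h0
      refine ⟨coeffAab a 1, Or.inl ⟨a, 1, rfl⟩, g, fun x hx => hg x (hSY x hx),
        fun x hx y hy => ?_, fun x _ y hy => ?_⟩
      · rw [hge x (hSY x hx) y (hSY y hy), coeffAab]
        push_cast; ring
      · have : a + (y : F) = 0 := by
          by_contra h0; exact hy (hS y h0)
        rw [coeffAab]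
        push_cast
        linear_combination this
  -- For `K ≠ 0` nothing is missing: a missing point has weight `0`, and its round trips would be `K
  -- * (x - y) ^ 2`. As functions of `y` the round trips are quadratic with leading coefficient `K`,
  -- so each `x` has finitely many bad partners.
  · have hSu : ∀ x, x ∈ S := by
      intro x
      by_contra hx
      have hx0 : a + (x : F) = 0 := by
        by_contra h0; exact hx (hS x h0)
      obtain ⟨y, hy⟩ := exists_ne x
      have := hP x y
      rw [roundTrip, hSe x y hx, hx0, zero_mul, zero_mul, zero_add] at this
      have h1 : (x : F) - y ≠ 0 := fun h0 => hy (hinj (sub_eq_zero.1 h0)).symm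
      exact mul_ne_zero hK (pow_ne_zero 2 h1) this.symm
    have hPk : ∀ x y : M, roundTrip (fun x y : M => coeffAab a b (y - x) x) x y =
        (a + x) * (a + y) + K * ((x : F) - y) ^ 2 := by
      intro x y
      simp only [roundTrip, coeffAab]
      rw [hb]
      push_cast
      ring
    obtain ⟨g, hg, hge⟩ := exists_rescaling e (fun x y => coeffAab a b (y - x) x) Set.univ
      Set.infinite_univ
      (by
        intro x _
        simp only [Set.mem_univ, true_and, hPk]
        obtain ⟨c1, hc1⟩ : ∃ c1 : F, c1 = a + x - 2 * K * x := ⟨_, rfl⟩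
        obtain ⟨c0, hc0⟩ : ∃ c0 : F, c0 = (a + x) * a + K * x ^ 2 := ⟨_, rfl⟩
        let f : Polynomial F := Polynomial.C K * Polynomial.X ^ 2 +
          Polynomial.C c1 * Polynomial.X + Polynomial.C c0
        have hf : f ≠ 0 := by
          intro h0
          have := congrArg (fun f => f.coeff 2) h0
          simp [f] at this
          exact hK this
        refine Set.Finite.of_finite_image (f := fun x : M => (x : F)) ?_ hinj.injOn
        refine (Polynomial.finite_setOfPred_isRoot hf).subset ?_
        rintro _ ⟨y, hy, rfl⟩
        simp only [Set.mem_ofPred_eq, Polynomial.IsRoot, f] at hy ⊢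
        simp [hc1, hc0]
        linear_combination hy)
      (fun x _ y _ => by rw [hP, hPk])
      (fun x _ y _ z _ => by
        rw [hT]; simp only [triangle, coeffAab]; push_cast; ring)
    exact ⟨_, Or.inl ⟨a, b, rfl⟩, g, fun x _ => hg x trivial,
      fun x _ y _ => hge x trivial y trivial, fun x _ y hy => absurd (hSu y) hy⟩

end Gauge


/-! ### Weight spaces, splittings, and realisation as a subquotient -/

section Representation

universe u w

variable {F : Type u} [Field F] {M : AddSubgroup F}

/-- Induction over the basis elements of `Vir[M]` for membership in a submodule. -/
theorem vir_induction (p : Submodule F (Vir M)) (hL : ∀ μ, L μ ∈ p) (hc : c M ∈ p) (x : Vir M) :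
    x ∈ p := by
  have h : (⊤ : Submodule F (Vir M)) ≤ p := by
    rw [← (virBasis M).span_eq, Submodule.span_le]
    rintro _ ⟨i, rfl⟩
    cases i with
    | none => exact hc
    | some μ => exact hL μ
  exact h trivial

variable [CharZero F]

theorem lie_L_L (μ ν : M) : ⁅L μ, L ν⁆ = basisBracket (some μ) (some ν) := virBracket_L_L μ ν

theorem lie_c (x : Vir M) : ⁅x, c M⁆ = 0 := virBracket_c_right x

variable {V : Type w} [AddCommGroup V] [LieRingModule (Vir M) V]

theorem lie_c_lie (x : Vir M) (v : V) : ⁅c M, ⁅x, v⁆⁆ = ⁅x, ⁅c M, v⁆⁆ := by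
  rw [leibniz_lie x, lie_c, zero_lie, zero_add]

variable [Module F V] [LieModule F (Vir M) V]

theorem mem_weightSpace {l : F} {v : V} : v ∈ weightSpace M V l ↔ ⁅L (0 : M), v⁆ = l • v := by
  rw [weightSpace, Module.End.mem_eigenspace_iff]; rfl

theorem lie_L_L_lie (μ ν : M) (v : V) : ⁅L μ, ⁅L ν, v⁆⁆ - ⁅L ν, ⁅L μ, v⁆⁆ =
    ((ν : F) - μ) • ⁅L (μ + ν), v⁆ +
      (open Classical in
        if μ + ν = 0 then (1 / 12 : F) * ((μ : F) ^ 3 - (μ : F)) else 0) • ⁅c M, v⁆ := by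
  rw [leibniz_lie, add_sub_cancel_right, lie_L_L, basisBracket, add_lie, smul_lie, smul_lie]

theorem lie_L_mem_weightSpace {l : F} {v : V} (hv : v ∈ weightSpace M V l) (μ : M) :
    ⁅L μ, v⁆ ∈ weightSpace M V (l + μ) := by
  rw [mem_weightSpace] at hv ⊢
  have := lie_L_L_lie 0 μ v
  rw [hv, zero_add] at this
  simp only [lie_smul, ZeroMemClass.coe_zero, sub_zero] at this
  rw [sub_eq_iff_eq_add] at this
  rw [this]
  by_cases h : μ = 0
  · simp [h]
  · simp only [h, if_false, zero_smul, add_zero]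
    module

theorem lie_c_mem_weightSpace {l : F} {v : V} (hv : v ∈ weightSpace M V l) :
    ⁅c M, v⁆ ∈ weightSpace M V l := by
  rw [mem_weightSpace] at hv ⊢
  rw [← lie_c_lie, hv, lie_smul]

/-- A property of weights which is respected by the action holds for all weights of an
indecomposable weight module or for none. -/
theorem weights_dichotomy (hint : iSup (weightSpace M V) = ⊤) (hind : IsIndecomposable M V)
    (Q : F → Prop)
    (hQ : ∀ (l : F) (μ : M), ¬ (Q l ↔ Q (l + μ)) → ∀ v ∈ weightSpace M V l, ⁅L μ, v⁆ = 0) :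
    (∀ l, Q l → weightSpace M V l = ⊥) ∨ ∀ l, ¬ Q l → weightSpace M V l = ⊥ := by
  have stable : ∀ Q : F → Prop,
      (∀ (l : F) (μ : M), ¬ (Q l ↔ Q (l + μ)) → ∀ v ∈ weightSpace M V l, ⁅L μ, v⁆ = 0) →
      ∀ x : Vir M, ∀ v ∈ ⨆ l ∈ {l | Q l}, weightSpace M V l,
        ⁅x, v⁆ ∈ ⨆ l ∈ {l | Q l}, weightSpace M V l := by
    intro Q hQ x v hv
    have hle : ⨆ l ∈ {l | Q l}, weightSpace M V l ≤
        (⨆ l ∈ {l | Q l}, weightSpace M V l).comap (LieModule.toEnd F (Vir M) V x) := by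
      refine iSup₂_le fun l hl v hv => ?_
      let p : Submodule F (Vir M) := (⨆ l ∈ {l | Q l}, weightSpace M V l).comap
        ((LieModule.toEnd F (Vir M) V : Vir M →ₗ[F] Module.End F V).flip v)
      refine vir_induction p (fun μ => ?_) ?_ x
      · change ⁅L μ, v⁆ ∈ ⨆ l ∈ {l | Q l}, weightSpace M V l
        by_cases h : Q (l + μ)
        · exact Submodule.mem_iSup_of_mem _ (Submodule.mem_iSup_of_mem h
            (lie_L_mem_weightSpace hv μ))
        · rw [hQ l μ (fun h' => h (h'.1 hl)) v hv]
          exact zero_mem _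
      · change ⁅c M, v⁆ ∈ ⨆ l ∈ {l | Q l}, weightSpace M V l
        exact Submodule.mem_iSup_of_mem _ (Submodule.mem_iSup_of_mem hl
            (lie_c_mem_weightSpace hv))
    exact hle hv
  -- Weights satisfying `Q` and weights violating it span complementary submodules, so one of the
  -- two is zero.
  let N : (F → Prop) → Submodule F V := fun Q => ⨆ l ∈ {l | Q l}, weightSpace M V l
  let N1 : LieSubmodule F (Vir M) V :=
    { N Q with lie_mem := fun {x v} hv => stable Q hQ x v hv }
  let N2 : LieSubmodule F (Vir M) V :=
    { N (fun l => ¬ Q l) with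
      lie_mem := fun {x v} hv => stable (fun l => ¬ Q l)
        (fun l μ h => hQ l μ (fun h' => h (not_congr h'))) x v hv }
  have hcompl : IsCompl N1 N2 := by
    rw [← LieSubmodule.isCompl_toSubmodule]
    change IsCompl (N Q) (N fun l => ¬ Q l)
    constructor
    · refine iSupIndep.disjoint_biSup_biSup
        (Module.End.eigenspaces_iSupIndep (LieModule.toEnd F (Vir M) V (L (0 : M)))) ?_
      rw [Set.disjoint_left]
      exact fun l h1 h2 => h2 h1
    · rw [codisjoint_iff, eq_top_iff, ← hint]
      refine iSup_le fun l => ?_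
      by_cases hl : Q l
      · exact le_sup_of_le_left (le_biSup (weightSpace M V) hl)
      · exact le_sup_of_le_right (le_biSup (weightSpace M V) hl)
  rcases hind.2 N1 N2 hcompl with h | h
  · left
    intro l hl
    have : N Q = ⊥ := by
      change N1.toSubmodule = ⊥
      rw [h]; rfl
    rw [eq_bot_iff, ← this]
    exact le_biSup (weightSpace M V) hl
  · right
    intro l hl
    have : N (fun l => ¬ Q l) = ⊥ := by
      change N2.toSubmodule = ⊥
      rw [h]; rfl
    rw [eq_bot_iff, ← this]
    exact le_biSup (weightSpace M V) (i := l) hl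

/-- A module with a basis on which the action is given by standard coefficients is a
subquotient. -/
theorem isNonzeroSubquotient_of_basis (X : Type u) [AddCommGroup X] [Module F X]
    [LieRingModule (Vir M) X] [LieModule F (Vir M) X] (k : M → M → F) (φ : X ≃ₗ[F] (M →₀ F))
    (hφ : ∀ (x : Vir M) (v : X), φ ⁅x, v⁆ = coeffAction k x (φ v)) (S : Set M) (hS : S.Nonempty)
    (hkS : ∀ x ∈ S, ∀ μ : M, μ + x ∉ S → k μ x = 0) (b : M → V)
    (hli : LinearIndependent F fun x : S => b x)
    (hspan : ⊤ ≤ Submodule.span F (b '' S))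
    (hL : ∀ x ∈ S, ∀ μ : M, ⁅L μ, b x⁆ = k μ x • b (μ + x)) (hc : ∀ v : V, ⁅c M, v⁆ = 0) :
    IsNonzeroSubquotient M V X := by
  set T : Submodule F (M →₀ F) := Finsupp.supported F F S with hT
  have hTspan : T = Submodule.span F ((fun i => Finsupp.single i (1 : F)) '' S) :=
    Finsupp.supported_eq_span_single F S
  have hTstable : ∀ (x : Vir M), ∀ t ∈ T, coeffAction k x t ∈ T := by
    intro x t ht
    refine vir_induction (T.comap ((coeffAction k).flip t)) (fun μ => ?_) ?_ x
    · change coeffAction k (L μ) t ∈ T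
      have : T ≤ T.comap (coeffAction k (L μ)) := by
        nth_rewrite 1 [hTspan]
        rw [Submodule.span_le]
        rintro _ ⟨y, hy, rfl⟩
        simp only [SetLike.mem_coe, Submodule.mem_comap, coeffAction_L, mul_one]
        by_cases h : μ + y ∈ S
        · exact Finsupp.single_mem_supported F _ h
        · rw [hkS y hy μ h, Finsupp.single_zero]; exact zero_mem _
      exact this ht
    · change coeffAction k (c M) t ∈ T
      rw [coeffAction_c]; exact zero_mem _
  -- The basis vectors indexed by `S` already span a submodule, so the lower term of the subquotient
  -- is `⊥`.
  let N : LieSubmodule F (Vir M) X :=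
    { T.comap (φ : X →ₗ[F] (M →₀ F)) with
      lie_mem := fun {x v} hv => by
        change φ ⁅x, v⁆ ∈ T
        rw [hφ]
        exact hTstable x _ hv }
  have hN : ∀ v : X, v ∈ N ↔ φ v ∈ T := fun v => Iff.rfl
  let f : (M →₀ F) →ₗ[F] V := Finsupp.linearCombination F b
  have hf : ∀ (x : Vir M), ∀ t ∈ T, f (coeffAction k x t) = ⁅x, f t⁆ := by
    intro x t ht
    let A : Vir M →ₗ[F] V := f ∘ₗ (coeffAction k).flip t
    let B : Vir M →ₗ[F] V := (LieModule.toEnd F (Vir M) V : Vir M →ₗ[F] Module.End F V).flip (f t)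
    refine vir_induction (LinearMap.eqLocus A B) (fun μ => ?_) ?_ x
    · change f (coeffAction k (L μ) t) = ⁅L μ, f t⁆
      have : T ≤ LinearMap.eqLocus (f ∘ₗ coeffAction k (L μ))
          (LieModule.toEnd F (Vir M) V (L μ) ∘ₗ f) := by
        rw [hTspan, Submodule.span_le]
        rintro _ ⟨y, hy, rfl⟩
        change f (coeffAction k (L μ) (Finsupp.single y 1)) = ⁅L μ, f (Finsupp.single y 1)⁆
        simp only [f, coeffAction_L, mul_one, Finsupp.linearCombination_single, one_smul]
        rw [hL y hy]
      exact this ht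
    · change f (coeffAction k (c M) t) = ⁅c M, f t⁆
      rw [coeffAction_c, map_zero, hc]
  have hfinj : ∀ t ∈ T, f t = 0 → t = 0 := by
    intro t ht h0
    have := linearIndepOn_iff.1 (show LinearIndepOn F b S from hli) t ht h0
    exact this
  have hfsurj : ∀ v : V, ∃ t ∈ T, f t = v := by
    intro v
    have hv := hspan (show v ∈ (⊤ : Submodule F V) from trivial)
    rw [Finsupp.span_image_eq_map_linearCombination] at hv
    exact hv
  let ψ : N →ₗ[F] V := f ∘ₗ (φ : X →ₗ[F] (M →₀ F)) ∘ₗ N.toSubmodule.subtype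
  have hψ : Function.Bijective ψ := by
    constructor
    · rw [← LinearMap.ker_eq_bot, LinearMap.ker_eq_bot']
      intro n hn
      have := hfinj (φ n) n.2 hn
      exact Subtype.ext (φ.map_eq_zero_iff.1 this)
    · intro v
      obtain ⟨t, ht, rfl⟩ := hfsurj v
      exact ⟨⟨φ.symm t, by rw [hN, φ.apply_symm_apply]; exact ht⟩,
        congrArg f (φ.apply_symm_apply t)⟩
  have hψlie : ∀ (x : Vir M) (n : N), ψ ⁅x, n⁆ = ⁅x, ψ n⁆ := by
    intro x n
    change f (φ ⁅x, (n : X)⁆) = ⁅x, f (φ n)⁆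
    rw [hφ]
    exact hf x _ n.2
  let ψe : N ≃ₗ[F] V := LinearEquiv.ofBijective ψ hψ
  let P : LieSubmodule F (Vir M) N := (⊥ : LieSubmodule F (Vir M) X).comap N.incl
  have hPbot : ∀ n : N, n ∈ P ↔ n = 0 := by
    intro n
    rw [LieSubmodule.mem_comap, LieSubmodule.mem_bot]
    exact ⟨fun h => Subtype.ext h, fun h => by rw [h]; rfl⟩
  let π : N →ₗ⁅F, Vir M⁆ (N ⧸ P) := LieSubmodule.Quotient.mk' P
  have hπ : Function.Bijective (fun v : V => π (ψe.symm v)) := by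
    constructor
    · intro v v' h
      have h1 : π (ψe.symm v - ψe.symm v') = 0 := by
        rw [map_sub, sub_eq_zero]; exact h
      rw [LieSubmodule.Quotient.mk_eq_zero, hPbot, sub_eq_zero] at h1
      exact ψe.symm.injective h1
    · intro y
      obtain ⟨n, rfl⟩ := LieSubmodule.Quotient.surjective_mk' P y
      exact ⟨ψe n, congrArg π (ψe.symm_apply_apply n)⟩
  let θ : V ≃ₗ[F] (N ⧸ P) :=
    LinearEquiv.ofBijective ((π : N →ₗ[F] (N ⧸ P)) ∘ₗ (ψe.symm : V →ₗ[F] N)) hπ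
  refine ⟨N, ⊥, ?_, ⟨{ θ with map_lie' := ?_ }⟩⟩
  · rw [bot_lt_iff_ne_bot]
    intro h0
    obtain ⟨x, hx⟩ := hS
    have hmem : φ.symm (Finsupp.single x 1) ∈ N := by
      rw [hN, φ.apply_symm_apply]
      exact Finsupp.single_mem_supported F _ hx
    rw [h0, LieSubmodule.mem_bot, φ.symm.map_eq_zero_iff] at hmem
    simp at hmem
  · intro x v
    change π (ψe.symm ⁅x, v⁆) = ⁅x, π (ψe.symm v)⁆
    rw [← LieModuleHom.map_lie]
    congr 1
    rw [LinearEquiv.symm_apply_eq]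
    change _ = ψ ⁅x, ψe.symm v⁆
    rw [hψlie]
    congr 1
    exact (ψe.apply_symm_apply v).symm

end Representation


/-! ### From a module of the intermediate series to standard coefficients -/

section Classification

universe u w

variable {F : Type u} [Field F] [CharZero F] {M : AddSubgroup F}
  {V : Type w} [AddCommGroup V] [Module F V] [LieRingModule (Vir M) V] [LieModule F (Vir M) V]

/-- The weights lie in one coset of `M`, which is taken to be `M` itself if possible. -/
theorem exists_weight_coset (hint : iSup (weightSpace M V) = ⊤) (hind : IsIndecomposable M V) :
    ∃ a : F, (a = 0 ∨ ∀ x : M, a + x ≠ 0) ∧ (∃ x : M, weightSpace M V (a + x) ≠ ⊥) ∧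
      ∀ l, weightSpace M V l ≠ ⊥ → ∃ x : M, l = a + x := by
  obtain ⟨l0, hl0⟩ : ∃ l, weightSpace M V l ≠ ⊥ := by
    by_contra! h
    have : (⊥ : Submodule F V) = ⊤ := by rw [← hint, iSup_eq_bot.2 h]
    have hn := hind.1
    exact bot_ne_top this
  obtain ⟨a, ha, x0, hx0⟩ : ∃ a : F, (a = 0 ∨ ∀ x : M, a + x ≠ 0) ∧ ∃ x : M, l0 = a + x := by
    by_cases hl : l0 ∈ M
    · exact ⟨0, Or.inl rfl, ⟨l0, hl⟩, by simp⟩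
    · refine ⟨l0, Or.inr fun x hx => hl ?_, 0, by simp⟩
      rw [eq_neg_of_add_eq_zero_left hx]
      exact neg_mem x.2
  refine ⟨a, ha, ⟨x0, hx0 ▸ hl0⟩, fun l hl => ?_⟩
  rcases weights_dichotomy hint hind (fun l => ∃ x : M, l = a + x) (by
    intro l μ h
    refine absurd ⟨?_, ?_⟩ h
    · rintro ⟨x, rfl⟩
      exact ⟨x + μ, by push_cast; ring⟩
    · rintro ⟨x, hx⟩
      exact ⟨x - μ, by push_cast; linear_combination hx⟩) with h | h
  · exact absurd (h l0 ⟨x0, hx0⟩) hl0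
  · by_contra h'
    exact hl (h l h')

/-- The central element acts by a scalar. -/
theorem exists_central_charge (hint : iSup (weightSpace M V) = ⊤) (hind : IsIndecomposable M V)
    (hone : ∀ l, ∃ v ∈ weightSpace M V l, ∀ w ∈ weightSpace M V l, ∃ t : F, t • v = w) :
    ∃ κ : F, ∀ v : V, ⁅c M, v⁆ = κ • v := by
  have hscal : ∀ l, ∃ κ : F, ∀ w ∈ weightSpace M V l, ⁅c M, w⁆ = κ • w := by
    intro l
    obtain ⟨v, hv, h⟩ := hone l
    obtain ⟨κ, hκ⟩ := h _ (lie_c_mem_weightSpace hv)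
    refine ⟨κ, fun w hw => ?_⟩
    obtain ⟨t, rfl⟩ := h w hw
    rw [lie_smul, ← hκ, smul_comm]
  choose κ hκ using hscal
  obtain ⟨l0, hl0⟩ : ∃ l, weightSpace M V l ≠ ⊥ := by
    by_contra! h
    have : (⊥ : Submodule F V) = ⊤ := by rw [← hint, iSup_eq_bot.2 h]
    have hn := hind.1
    exact bot_ne_top this
  have hall : ∀ l, ∀ w ∈ weightSpace M V l, ⁅c M, w⁆ = κ l0 • w := by
    rcases weights_dichotomy hint hind (fun l => κ l = κ l0) (by
      intro l μ h v hv
      have hne : κ l ≠ κ (l + μ) := fun h0 => h (by rw [h0])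
      have h1 := hκ _ _ (lie_L_mem_weightSpace hv μ)
      rw [lie_c_lie, hκ l v hv, lie_smul, ← sub_eq_zero, ← sub_smul] at h1
      exact (smul_eq_zero.1 h1).resolve_left (sub_ne_zero.2 hne)) with h | h
    · exact absurd (h l0 rfl) hl0
    · intro l w hw
      by_cases hl : κ l = κ l0
      · rw [hκ l w hw, hl]
      · rw [h l hl, Submodule.mem_bot] at hw
        rw [hw, lie_zero, smul_zero]
  refine ⟨κ l0, fun v => ?_⟩
  let p : Submodule F V := LinearMap.eqLocus (LieModule.toEnd F (Vir M) V (c M))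
    (κ l0 • LinearMap.id)
  have hp : iSup (weightSpace M V) ≤ p := iSup_le fun l w hw => hall l w hw
  rw [hint] at hp
  exact hp (x := v) trivial

/-- A module of the intermediate series has a standard weight basis. -/
theorem exists_standard_basis (hM : M ≠ ⊥) (hV : IsIntermediateSeries M V) :
    ∃ (k : M → M → F) (S : Set M) (b : M → V), IsStandardCoeff k ∧ S.Nonempty ∧
      (∀ x ∈ S, ∀ μ : M, μ + x ∉ S → k μ x = 0) ∧ (LinearIndependent F fun x : S => b x) ∧
      ⊤ ≤ Submodule.span F (b '' S) ∧
      (∀ x ∈ S, ∀ μ : M, ⁅L μ, b x⁆ = k μ x • b (μ + x)) ∧ ∀ v : V, ⁅c M, v⁆ = 0 := by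
  classical
  obtain ⟨⟨hint', hfin⟩, hind, hdim⟩ := hV
  have hint : iSup (weightSpace M V) = ⊤ := hint'.submodule_iSup_eq_top
  have hone : ∀ l, ∃ v ∈ weightSpace M V l, ∀ w ∈ weightSpace M V l, ∃ t : F, t • v = w := by
    intro l
    have := hfin l
    obtain ⟨v, hv⟩ := finrank_le_one_iff.1 (hdim l)
    refine ⟨v, v.2, fun w hw => ?_⟩
    obtain ⟨t, ht⟩ := hv ⟨w, hw⟩
    exact ⟨t, congrArg Subtype.val ht⟩
  obtain ⟨a, ha, ⟨x0, hx0⟩, hcoset⟩ := exists_weight_coset hint hind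
  obtain ⟨κ, hκ⟩ := exists_central_charge hint hind hone
  choose b' hb' hbspan' using hone
  set v : M → V := fun x => b' (a + x) with hv
  have hvW : ∀ x : M, v x ∈ weightSpace M V (a + x) := fun x => hb' _
  have hvspan : ∀ x : M, ∀ w ∈ weightSpace M V (a + x), ∃ t : F, t • v x = w := fun x => hbspan' _
  set S : Set M := {x | v x ≠ 0} with hS
  have hbot : ∀ x, x ∉ S → weightSpace M V (a + x) = ⊥ := by
    intro x hx
    rw [eq_bot_iff]
    intro w hw
    obtain ⟨t, rfl⟩ := hvspan x w hw
    simp only [hS, Set.mem_ofPred_eq, not_not] at hx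
    simp [hx]
  have hnbot : ∀ x, x ∈ S → weightSpace M V (a + x) ≠ ⊥ := by
    intro x hx h0
    have := hvW x
    rw [h0, Submodule.mem_bot] at this
    exact hx this
  have hSne : S.Nonempty := ⟨x0, by_contra fun h => hx0 (hbot x0 h)⟩
  have hvz : ∀ x, x ∉ S → v x = 0 := fun x hx => by simpa [hS] using hx
  have hLw : ∀ x y : M, ⁅L (y - x), v x⁆ ∈ weightSpace M V (a + y) := by
    intro x y
    have := lie_L_mem_weightSpace (hvW x) (y - x)
    rwa [show a + (x : F) + ((y - x : M) : F) = a + y by push_cast; ring] at this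
  -- Where `v x` or `v y` is zero the coefficient is not determined by the action; it is set to `0`,
  -- as `EdgeRel` requires.
  have hex : ∀ x y : M, ∃ t : F, (x ∉ S ∨ y ∉ S → t = 0) ∧ ⁅L (y - x), v x⁆ = t • v y := by
    intro x y
    by_cases hx : x ∈ S
    · by_cases hy : y ∈ S
      · obtain ⟨t, ht⟩ := hvspan y _ (hLw x y)
        exact ⟨t, fun h => absurd h (by simp [hx, hy]), ht.symm⟩
      · refine ⟨0, fun _ => rfl, ?_⟩
        have := hLw x y
        rw [hbot y hy, Submodule.mem_bot] at this
        rw [this, zero_smul]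
    · exact ⟨0, fun _ => rfl, by rw [hvz x hx, lie_zero, zero_smul]⟩
  choose e he0 he using hex
  have hcancel : ∀ y ∈ S, ∀ s t : F, s • v y = t • v y → s = t := fun y hy s t h =>
    smul_left_injective F hy h
  have hself : ∀ x ∈ S, e x x = a + x := by
    intro x hx
    apply hcancel x hx
    rw [← he, sub_self, ← mem_weightSpace]
    exact hvW x
  have hcomm : ∀ x y z y' : M, y + y' = x + z →
      (e x y * e y z - e x y' * e y' z) • v z = ((y : F) - y') • ⁅L (z - x), v x⁆ +
        (if z - x = 0 then (1 / 12 : F) * (((y' : F) - x) ^ 3 - ((y' : F) - x)) else 0) •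
          κ • v x := by
    intro x y z y' hy
    have h1 := lie_L_L_lie (y' - x) (y - x) (v x)
    have e1 : y' - x = z - y := by rw [sub_eq_sub_iff_add_eq_add, add_comm y', hy, add_comm]
    have e2 : y - x = z - y' := by rw [sub_eq_sub_iff_add_eq_add, hy, add_comm]
    have e3 : y' - x + (y - x) = z - x := by rw [e2]; abel
    rw [e3, hκ, he x y, lie_smul, he x y', lie_smul] at h1
    rw [show ⁅L (y' - x), v y⁆ = e y z • v z by rw [e1, he],
      show ⁅L (y - x), v y'⁆ = e y' z • v z by rw [e2, he], smul_smul, smul_smul, ← sub_smul] at h1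
    rw [h1]
    congr 2
    push_cast; ring
  have hrel : EdgeRel a S (κ / 12) e := by
    refine ⟨fun x y hx => he0 x y (Or.inl hx), fun x y hy => he0 x y (Or.inr hy), ?_, ?_⟩
    · intro x hx z hz hxz y y' hy
      apply hcancel z hz
      rw [hcomm x y z y' hy, if_neg (sub_ne_zero.2 hxz.symm), zero_smul, add_zero, he, smul_smul]
    · intro x hx μ
      apply hcancel x hx
      have := hcomm x (x + μ) x (x - μ) (by abel)
      rw [sub_self, if_pos rfl, ← sub_self x, he, hself x hx, smul_smul, smul_smul,
        ← add_smul] at this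
      rw [roundTrip, roundTrip, this]
      congr 1
      push_cast
      ring
  have hκ0 := hrel.charge_eq_zero hSne hM
  rw [hκ0] at hrel
  have hc : ∀ w : V, ⁅c M, w⁆ = 0 := by
    intro w
    have : κ = 0 := by simpa using hκ0
    rw [hκ, this, zero_smul]
  have hstd : ∃ k : M → M → F, IsStandardCoeff k ∧ ∃ g : M → F, (∀ x ∈ S, g x ≠ 0) ∧
      (∀ x ∈ S, ∀ y ∈ S, g x * e x y = g y * k (y - x) x) ∧
      ∀ x ∈ S, ∀ y, y ∉ S → k (y - x) x = 0 := by
    -- If a nonzero weight is missing, only the weight `0` occurs, and `V` is the trivial line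
    -- spanned by `v_0` in `A_{0,0}`.
    by_cases hmiss : ∃ m : M, m ∉ S ∧ a + (m : F) ≠ 0
    · obtain ⟨m, hm, hm0⟩ := hmiss
      have hzero : ∀ x ∈ S, a + (x : F) = 0 := fun x hx => hrel.support hm hm0 hx
      obtain ⟨x1, hx1⟩ := hSne
      have ha0 : a = 0 := ha.resolve_right fun h => h x1 (hzero x1 hx1)
      have hx : ∀ x ∈ S, x = 0 := fun x hx => Subtype.ext (by
        have := hzero x hx
        rwa [ha0, zero_add] at this)
      refine ⟨coeffAab 0 0, Or.inl ⟨0, 0, rfl⟩, fun _ => 1, fun _ _ => one_ne_zero, ?_, ?_⟩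
      · intro x hxS y hyS
        have := hself x hxS
        rw [hx x hxS] at this ⊢
        rw [hx y hyS, this, ha0, coeffAab]
        simp
      · intro x hxS y hyS
        rw [hx x hxS, coeffAab]
        simp
    · push Not at hmiss
      have hS' : ∀ x : M, a + (x : F) ≠ 0 → x ∈ S := fun x hx => by
        by_contra h; exact hx (hmiss x h)
      obtain ⟨h1, h2⟩ := hrel.extend hS' hself
      refine (h1.full h2).exists_standard hM ha hS' (fun x y hx => he0 x y (Or.inl hx)) ?_
      intro h0 ha0 hiso
      obtain ⟨δ, hδ⟩ := (AddSubgroup.ne_bot_iff_exists_ne_zero).1 hM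
      have hδS : δ ∈ S := hS' δ (by rw [ha0, zero_add]; exact fun h => hδ (Subtype.ext h))
      have hw0 := hnbot 0 h0
      have hwδ := hnbot δ hδS
      rw [ha0, zero_add] at hwδ hw0
      -- Without arrows at `0` the zero weight space would split off, although `δ` is a weight as
      -- well.
      rcases weights_dichotomy hint hind (fun l => l = 0) (by
        intro l μ h w hw
        by_cases hl : l = 0
        · subst hl
          have hμ : μ ≠ 0 := by
            rintro rfl; exact h (by simp)
          obtain ⟨t, rfl⟩ := hvspan 0 w (by rw [ha0]; simpa using hw)
          have := he 0 μ
          rw [sub_zero, (hiso μ hμ).1, zero_smul] at this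
          rw [lie_smul, this, smul_zero]
        · have hlμ : l + μ = 0 := by
            by_contra h'; exact h (by simp [hl, h'])
          have hl' : l = a + ((-μ : M) : F) := by
            rw [ha0]; push_cast; linear_combination hlμ
          have hμ : -μ ≠ 0 := by
            intro h'; apply hl; rw [hl', h', ha0]; simp
          obtain ⟨t, rfl⟩ := hvspan (-μ) w (by rwa [← hl'])
          have := he (-μ) 0
          rw [zero_sub, neg_neg, (hiso _ hμ).2, zero_smul] at this
          rw [lie_smul, this, smul_zero]) with h | h
      · exact hw0 (by simpa using h 0 rfl)
      · exact hwδ (h _ fun h' => hδ (Subtype.ext h'))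
  obtain ⟨k, hk, g, hg, hge, hgS⟩ := hstd
  have hkz : ∀ x ∈ S, ∀ μ : M, μ + x ∉ S → k μ x = 0 := by
    intro x hx μ h
    have := hgS x hx _ h
    rwa [add_sub_cancel_right] at this
  refine ⟨k, S, fun x => g x • v x, hk, hSne, hkz, ?_, ?_, ?_, hc⟩
  · refine Module.End.eigenvectors_linearIndependent' (LieModule.toEnd F (Vir M) V (L (0 : M)))
      (fun x : S => a + ((x : M) : F)) (fun x y h => ?_) _ fun x => ⟨?_, ?_⟩
    · exact Subtype.ext (Subtype.ext (add_left_cancel h))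
    · exact Submodule.smul_mem _ _ (hvW x)
    · exact smul_ne_zero (hg x x.2) x.2
  · rw [← hint]
    refine iSup_le fun l w hw => ?_
    by_cases hl : weightSpace M V l = ⊥
    · rw [hl, Submodule.mem_bot] at hw
      rw [hw]; exact zero_mem _
    · obtain ⟨x, rfl⟩ := hcoset l hl
      have hxS : x ∈ S := by_contra fun h => hl (hbot x h)
      obtain ⟨t, rfl⟩ := hvspan x w hw
      have : t • v x = (t * (g x)⁻¹) • (g x • v x) := by
        rw [smul_smul, mul_assoc, inv_mul_cancel₀ (hg x hxS), mul_one]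
      rw [this]
      exact Submodule.smul_mem _ _ (Submodule.subset_span ⟨x, hxS, rfl⟩)
  · intro x hx μ
    have h1 := he x (μ + x)
    rw [add_sub_cancel_right] at h1
    change ⁅L μ, g x • v x⁆ = k μ x • g (μ + x) • v (μ + x)
    rw [lie_smul, h1]
    by_cases h : μ + x ∈ S
    · have h2 := hge x hx _ h
      rw [add_sub_cancel_right] at h2
      rw [smul_smul, smul_smul, h2, mul_comm]
    · rw [hvz _ h]; simp

end Classification

end GenVir

theorem theorem4p6 {F : Type*} [Field F] [CharZero F] (M : AddSubgroup F) (hM : M ≠ ⊥)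
    (V : Type*) [AddCommGroup V] [Module F V] [LieRingModule (GenVir.Vir M) V]
    [LieModule F (GenVir.Vir M) V] (hV : GenVir.IsIntermediateSeries M V) :
    (∃ a b : F, Nonempty (V ≃ₗ⁅F, GenVir.Vir M⁆ GenVir.ModAab M a b) ∨
      GenVir.IsNonzeroSubquotient M V (GenVir.ModAab M a b)) ∨
    (∃ a : F, Nonempty (V ≃ₗ⁅F, GenVir.Vir M⁆ GenVir.ModA M a) ∨
      GenVir.IsNonzeroSubquotient M V (GenVir.ModA M a)) ∨
    (∃ a : F, Nonempty (V ≃ₗ⁅F, GenVir.Vir M⁆ GenVir.ModB M a) ∨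
      GenVir.IsNonzeroSubquotient M V (GenVir.ModB M a)) := by
  obtain ⟨k, S, b, hk, hS, hkS, hli, hspan, hL, hc⟩ := GenVir.exists_standard_basis hM hV
  -- The subquotient alternative always suffices: for `S` all of `M` it is the whole module.
  rcases hk with ⟨a, b', rfl⟩ | ⟨a, rfl⟩ | ⟨a, rfl⟩
  · exact Or.inl ⟨a, b', Or.inr (GenVir.isNonzeroSubquotient_of_basis (GenVir.ModAab M a b')
      (GenVir.coeffAab a b') (LinearEquiv.refl F (M →₀ F)) (fun _ _ => rfl) S hS hkS b hli hspan
      hL hc)⟩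
  · exact Or.inr (Or.inl ⟨a, Or.inr (GenVir.isNonzeroSubquotient_of_basis (GenVir.ModA M a)
      (GenVir.coeffA a) (LinearEquiv.refl F (M →₀ F)) (fun _ _ => rfl) S hS hkS b hli hspan
      hL hc)⟩)
  · exact Or.inr (Or.inr ⟨a, Or.inr (GenVir.isNonzeroSubquotient_of_basis (GenVir.ModB M a)
      (GenVir.coeffB a) (LinearEquiv.refl F (M →₀ F)) (fun _ _ => rfl) S hS hkS b hli hspan
      hL hc)⟩)
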